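/- **Setting.** Let $X,Y$ take values in finite sets $\mathcal X,\mathcal Y$ and let $U^1,\dots,U^t$ be binary random variables, jointly distributed with $(X,Y)$, such that $U^i\to(X,U^{1:i-1})\to Y$ is a Markov chain for odd $i$ and $U^i\to(Y,U^{1:i-1})\to X$ is a Markov chain for even $i$. Here $U^{1:i}=(U^1,\dots,U^i)$. Let $N=2^n$, let $G_N=B_NF^{\otimes n}$ over $\mathbb F_2$, where $F=\begin{pmatrix}1&0\\1&1\end{pmatrix}$ and $B_N$ is the bit-reversal permutation matrix, and let $P$ be the law of $N$ independent copies $(\bar X,\bar Y,\bar U^1,\dots,\bar U^t)$ of $(X,Y,U^1,\dots,U^t)$, together with $\bar V^i=\bar U^iG_N$. For a bit $T$ and a discrete $S$ put $Z(T|S)=2\sum_sP_S(s)\sqrt{P_{T|S}(0|s)P_{T|S}(1|s)}$. Fix $\beta\in(0,1/2)$, put $\delta_N=2^{-N^\beta}$, and for a part $S$ of $(\bar X,\bar Y,\bar U^{1},\dots,\bar U^t)$ (possibly empty) let $$\mathcal H_{U^i|S}=\{j\in[N]: Z((V^i)^j\mid (V^i)^{1:j-1},S)\ge 1-\delta_N\},\qquad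 \mathcal L_{U^i|S}=\{j\in[N]: Z((V^i)^j\mid (V^i)^{1:j-1},S)\le \delta_N\},$$ where $(V^i)^j$ is the $j$-th coordinate of $\bar V^i$; write $\mathcal L_{U^i}$ if $S$ is empty. **Protocol.** Terminal A observes $\bar X$ and Terminal B observes $\bar Y$. In round $i=1,\dots,t$ the sender is A if $i$ is odd and B if $i$ is even. Let $S=(\bar X,\bar U^{1},\dots,\bar U^{i-1})$ and $R=(\bar Y,\bar U^{1},\dots,\bar U^{i-1})$ if $i$ is odd, and conversely if $i$ is even, and put $$\mathcal F_r=\mathcal L_{U^i}^c\cap\mathcal H_{U^i|S},\quad \mathcal F_d=\mathcal L_{U^i},\quad \mathcal I=\mathcal L_{U^i}^c\cap\mathcal H_{U^i|S}^c,\quad \mathcal I'=\mathcal I\setminus(\mathcal L_{U^i}^c\cap\mathcal L_{U^i|R}).$$ The sender generates a vector $\bar v$ bit by bit: given its earlier bits $v^{1:j-1}$ and the value $s$ of $S$ formed by its own observation and its own versions of the earlier vectors, the bit $v^j$ has the law $(1/2,1/2)$ if $j\in\mathcal F_r$, $P_{(V^i)^j|(V^i)^{1:j-1}}(\cdot|v^{1:j-1})$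 if $j\in\mathcal F_d$, and $P_{(V^i)^j|(V^i)^{1:j-1},S}(\cdot|v^{1:j-1},s)$ if $j\in\mathcal I$. The receiver generates its own vector in the same way: the bits $j\in\mathcal F_r$ are equal to the sender's (they are common randomness of the terminals), the bits $j\in\mathcal I'$ are received from the sender, the bits $j\in\mathcal F_d$ have the law $P_{(V^i)^j|(V^i)^{1:j-1}}$ given the receiver's earlier bits, and the bits $j\in\mathcal I\setminus\mathcal I'$ have the law $P_{(V^i)^j|(V^i)^{1:j-1},R}$ given the receiver's earlier bits and its own value of $R$. All randomness, apart from the common bits, is independent between the terminals, and all of it is independent between bits and rounds; a conditional law given an event of $P$-probability zero is taken to be $(1/2,1/2)$. Each terminal multiplies its vector by $G_N$ and obtains its version $\bar U_A^i$, respectively $\bar U_B^i$, of $\bar U^i$. Write $\mathbf U_A^{1:t}=(\bar U_A^1,\dots,\bar U_A^t)$, similarly $\mathbf U_B^{1:t}$ and $\mathbf U^{1:t}$, and let $Q$ denote the laws that arise in this protocol when $(\bar X,\bar Y)$ has the law $P_{\bar X\bar Y}$. **Lemma.** For every $\beta\in(0,1/2)$ and every real $\beta_3<\beta$, as $N=2^n\to\infty$,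 $$\Pr\{\mathbf U_A^{1:t}=\mathbf U_B^{1:t}\}=1-O(2^{-N^{\beta_3}}),$$ $$\|Q_{\mathbf U_A^{1:t}\bar X\bar Y}-P_{\mathbf U^{1:t}\bar X\bar Y}\|_1=O(2^{-N^{\beta_3}}),\qquad \|Q_{\mathbf U_B^{1:t}\bar X\bar Y}-P_{\mathbf U^{1:t}\bar X\bar Y}\|_1=O(2^{-N^{\beta_3}}),$$ where $\|\mu-\nu\|_1=\sum_\omega|\mu(\omega)-\nu(\omega)|$. -/

import Mathlib

noncomputable section

namespace InteractivePolar

/-! ### Finite probability -/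

section Probability

variable {Ω 𝒮 : Type*} [Fintype Ω]

open Classical in
/-- The probability of the event `E` under the mass function `μ` on a finite set. -/
def pr (μ : Ω → ℝ) (E : Ω → Prop) : ℝ :=
  ∑ ω, if E ω then μ ω else 0

open Classical in
/-- The conditional probability `P(T = a | S = s)` of a bit `T`. If `P(S = s) = 0`, the value
is `1/2`, so that this is always a probability distribution in `a`. -/
def condBit (μ : Ω → ℝ) (T : Ω → ZMod 2) (S : Ω → 𝒮) (a : ZMod 2) (s : 𝒮) : ℝ :=
  if pr μ (fun ω => S ω = s) = 0 then 1 / 2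
  else pr μ (fun ω => T ω = a ∧ S ω = s) / pr μ (fun ω => S ω = s)

/-- The Bhattacharyya parameter `Z(T|S) = 2 ∑ₛ P(s) √(P(0|s) P(1|s))` of a bit `T` given `S`. -/
def bhattacharyya [Fintype 𝒮] (μ : Ω → ℝ) (T : Ω → ZMod 2) (S : Ω → 𝒮) : ℝ :=
  2 * ∑ s, pr μ (fun ω => S ω = s) * √(condBit μ T S 0 s * condBit μ T S 1 s)

/-- The Markov chain `A → B → C`: `A` and `C` are conditionally independent given `B`. -/
def IsMarkovChain {α γ δ : Type*} (μ : Ω → ℝ) (A : Ω → α) (B : Ω → γ) (C : Ω → δ) : Prop :=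
  ∀ a b c,
    pr μ (fun ω => A ω = a ∧ B ω = b ∧ C ω = c) * pr μ (fun ω => B ω = b) =
      pr μ (fun ω => A ω = a ∧ B ω = b) * pr μ (fun ω => B ω = b ∧ C ω = c)

end Probability

/-! ### The polarizing matrix -/

/-- The kernel `F`. -/
def kernelF : Matrix (Fin 2) (Fin 2) (ZMod 2) := !![1, 0; 1, 1]

/-- The Kronecker power `F^{⊗ n}`. -/
def kroneckerPow : (n : ℕ) → Matrix (Fin (2 ^ n)) (Fin (2 ^ n)) (ZMod 2)
  | 0 => 1
  | n + 1 =>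
    let e : Fin 2 × Fin (2 ^ n) ≃ Fin (2 ^ (n + 1)) :=
      finProdFinEquiv.trans (finCongr (pow_succ' 2 n).symm)
    Matrix.reindex e e (Matrix.kronecker kernelF (kroneckerPow n))

/-- The bit reversal permutation of the `n`-bit indices. -/
def bitReversal (n : ℕ) : Equiv.Perm (Fin (2 ^ n)) :=
  finFunctionFinEquiv.symm.trans
    ((Equiv.arrowCongr Fin.revPerm (Equiv.refl (Fin 2))).trans finFunctionFinEquiv)

/-- The matrix `G_N = B_N F^{⊗ n}`, where `N = 2 ^ n`. -/
def polarMatrix (n : ℕ) : Matrix (Fin (2 ^ n)) (Fin (2 ^ n)) (ZMod 2) :=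
  (bitReversal n).permMatrix (ZMod 2) * kroneckerPow n

/-- The polarizing transform `u ↦ u G_N` of a row vector. -/
def polarTransform (n : ℕ) (u : Fin (2 ^ n) → ZMod 2) : Fin (2 ^ n) → ZMod 2 :=
  Matrix.vecMul u (polarMatrix n)

/-! ### The ideal distribution

Rounds are indexed from `0`, so that round `i : Fin t` is the `(i + 1)`-st one: Terminal A sends
if `i` is even, and Terminal B sends if `i` is odd. -/

section Source

variable {𝒳 𝒴 : Type*} [Fintype 𝒳] [Fintype 𝒴] {t : ℕ}

/-- The joint mass function of `(X, Y, U¹, …, Uᵗ)` with real values. -/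
def letterLaw (p : PMF (𝒳 × 𝒴 × (Fin t → ZMod 2))) : 𝒳 × 𝒴 × (Fin t → ZMod 2) → ℝ :=
  fun w => (p w).toReal

/-- The Markov conditions: `Uⁱ → (X, U^{1:i-1}) → Y` in the rounds in which A sends, and
`Uⁱ → (Y, U^{1:i-1}) → X` in the rounds in which B sends. -/
def MarkovConditions (p : PMF (𝒳 × 𝒴 × (Fin t → ZMod 2))) : Prop :=
  ∀ i : Fin t,
    (Even (i : ℕ) → IsMarkovChain (letterLaw p) (fun w => w.2.2 i)
      (fun w => (w.1, Fin.take i i.isLt.le w.2.2)) (fun w => w.2.1)) ∧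
    (¬ Even (i : ℕ) → IsMarkovChain (letterLaw p) (fun w => w.2.2 i)
      (fun w => (w.2.1, Fin.take i i.isLt.le w.2.2)) (fun w => w.1))

/-- Realizations `(x̄, ȳ, ū¹, …, ūᵗ)` of blocks of length `N = 2 ^ n`. -/
abbrev Block (𝒳 𝒴 : Type*) (t n : ℕ) : Type _ :=
  (Fin (2 ^ n) → 𝒳) × (Fin (2 ^ n) → 𝒴) × (Fin t → Fin (2 ^ n) → ZMod 2)

/-- The ideal law `P` of `(X̄, Ȳ, Ū¹, …, Ūᵗ)`: `N` independent copies of `(X, Y, U¹, …, Uᵗ)`. -/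
def blockLaw (p : PMF (𝒳 × 𝒴 × (Fin t → ZMod 2))) (n : ℕ) : Block 𝒳 𝒴 t n → ℝ :=
  fun ω => ∏ k, letterLaw p (ω.1 k, ω.2.1 k, fun i => ω.2.2 i k)

/-- The law of the observations `(X̄, Ȳ)`. -/
def sourceLaw (p : PMF (𝒳 × 𝒴 × (Fin t → ZMod 2))) (n : ℕ)
    (x : Fin (2 ^ n) → 𝒳) (y : Fin (2 ^ n) → 𝒴) : ℝ :=
  ∏ k, pr (letterLaw p) (fun w => w.1 = x k ∧ w.2.1 = y k)

/-- No side information. -/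
def noSide (n : ℕ) : Block 𝒳 𝒴 t n → Unit := fun _ => ()

/-- The side information `(X̄, U^{1:i})` of Terminal A before round `i`. -/
def sideA (n : ℕ) (i : Fin t) :
    Block 𝒳 𝒴 t n → (Fin (2 ^ n) → 𝒳) × (Fin i → Fin (2 ^ n) → ZMod 2) :=
  fun ω => (ω.1, Fin.take i i.isLt.le ω.2.2)

/-- The side information `(Ȳ, U^{1:i})` of Terminal B before round `i`. -/
def sideB (n : ℕ) (i : Fin t) :
    Block 𝒳 𝒴 t n → (Fin (2 ^ n) → 𝒴) × (Fin i → Fin (2 ^ n) → ZMod 2) :=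
  fun ω => (ω.2.1, Fin.take i i.isLt.le ω.2.2)

section Round

variable {𝒮 ℛ : Type*}

/-- The vector `V̄ = Ū G_N` of round `i`. -/
def vVec (n : ℕ) (i : Fin t) (ω : Block 𝒳 𝒴 t n) : Fin (2 ^ n) → ZMod 2 :=
  polarTransform n (ω.2.2 i)

/-- The ideal conditional probability `P(V^j = v^j | V^{1:j-1} = v^{1:j-1}, S = s)` in round `i`,
for the side information `S`. -/
def idealBit (p : PMF (𝒳 × 𝒴 × (Fin t → ZMod 2))) (n : ℕ) (i : Fin t)
    (S : Block 𝒳 𝒴 t n → 𝒮) (j : Fin (2 ^ n)) (v : Fin (2 ^ n) → ZMod 2) (s : 𝒮) : ℝ :=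
  condBit (blockLaw p n) (fun ω => vVec n i ω j)
    (fun ω => (Fin.take j j.isLt.le (vVec n i ω), S ω)) (v j) (Fin.take j j.isLt.le v, s)

/-- The Bhattacharyya parameter `Z(V^j | V^{1:j-1}, S)` in round `i`. -/
def zParam [Fintype 𝒮] (p : PMF (𝒳 × 𝒴 × (Fin t → ZMod 2))) (n : ℕ) (i : Fin t)
    (S : Block 𝒳 𝒴 t n → 𝒮) (j : Fin (2 ^ n)) : ℝ :=
  bhattacharyya (blockLaw p n) (fun ω => vVec n i ω j)
    (fun ω => (Fin.take j j.isLt.le (vVec n i ω), S ω))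

/-- The threshold `δ_N = 2^{-N^β}`, where `N = 2 ^ n`. -/
def threshold (β : ℝ) (n : ℕ) : ℝ := (2 : ℝ) ^ (-(((2 : ℝ) ^ n) ^ β))

/-- The set `𝓗` of the indices of the nearly uniform bits given `S`. -/
def highSet [Fintype 𝒮] (p : PMF (𝒳 × 𝒴 × (Fin t → ZMod 2))) (β : ℝ) (n : ℕ) (i : Fin t)
    (S : Block 𝒳 𝒴 t n → 𝒮) : Set (Fin (2 ^ n)) :=
  {j | 1 - threshold β n ≤ zParam p n i S j}

/-- The set `𝓛` of the indices of the nearly deterministic bits given `S`. -/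
def lowSet [Fintype 𝒮] (p : PMF (𝒳 × 𝒴 × (Fin t → ZMod 2))) (β : ℝ) (n : ℕ) (i : Fin t)
    (S : Block 𝒳 𝒴 t n → 𝒮) : Set (Fin (2 ^ n)) :=
  {j | zParam p n i S j ≤ threshold β n}

/-- `𝓕_r`, where `S` is the side information of the sender of round `i`. -/
def randomSet [Fintype 𝒮] (p : PMF (𝒳 × 𝒴 × (Fin t → ZMod 2))) (β : ℝ) (n : ℕ) (i : Fin t)
    (S : Block 𝒳 𝒴 t n → 𝒮) : Set (Fin (2 ^ n)) :=
  (lowSet p β n i (noSide n))ᶜ ∩ highSet p β n i S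

/-- `𝓕_d`. -/
def deterministicSet (p : PMF (𝒳 × 𝒴 × (Fin t → ZMod 2))) (β : ℝ) (n : ℕ) (i : Fin t) :
    Set (Fin (2 ^ n)) :=
  lowSet p β n i (noSide n)

/-- `𝓘`, where `S` is the side information of the sender of round `i`. -/
def infoSet [Fintype 𝒮] (p : PMF (𝒳 × 𝒴 × (Fin t → ZMod 2))) (β : ℝ) (n : ℕ) (i : Fin t)
    (S : Block 𝒳 𝒴 t n → 𝒮) : Set (Fin (2 ^ n)) :=
  (lowSet p β n i (noSide n))ᶜ ∩ (highSet p β n i S)ᶜ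

/-- `𝓘'`, the indices of the transmitted bits, where `S` and `R` are the side information of the
sender and of the receiver of round `i`. -/
def sentSet [Fintype 𝒮] [Fintype ℛ] (p : PMF (𝒳 × 𝒴 × (Fin t → ZMod 2))) (β : ℝ) (n : ℕ)
    (i : Fin t) (S : Block 𝒳 𝒴 t n → 𝒮) (R : Block 𝒳 𝒴 t n → ℛ) : Set (Fin (2 ^ n)) :=
  infoSet p β n i S \ ((lowSet p β n i (noSide n))ᶜ ∩ lowSet p β n i R)

open Classical in
/-- The probability that the sender of round `i` gives its `j`-th bit the value `v j`, given its
earlier bits and its side information `s`. -/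
def senderBit [Fintype 𝒮] (p : PMF (𝒳 × 𝒴 × (Fin t → ZMod 2))) (β : ℝ) (n : ℕ) (i : Fin t)
    (S : Block 𝒳 𝒴 t n → 𝒮) (j : Fin (2 ^ n)) (v : Fin (2 ^ n) → ZMod 2) (s : 𝒮) : ℝ :=
  if j ∈ randomSet p β n i S then 1 / 2
  else if j ∈ deterministicSet p β n i then idealBit p n i (noSide n) j v ()
  else idealBit p n i S j v s

open Classical in
/-- The probability that the receiver of round `i` gives its `j`-th bit the value `v j`, given its
earlier bits and its side information `r`, for an index `j` that is not transmitted. -/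
def receiverBit [Fintype 𝒮] (p : PMF (𝒳 × 𝒴 × (Fin t → ZMod 2))) (β : ℝ) (n : ℕ) (i : Fin t)
    (S : Block 𝒳 𝒴 t n → 𝒮) (R : Block 𝒳 𝒴 t n → ℛ) (j : Fin (2 ^ n))
    (v : Fin (2 ^ n) → ZMod 2) (r : ℛ) : ℝ :=
  if j ∈ randomSet p β n i S then 1 / 2
  else if j ∈ deterministicSet p β n i then idealBit p n i (noSide n) j v ()
  else idealBit p n i R j v r

open Classical in
/-- The joint law of the vectors `vS` of the sender and `vR` of the receiver in round `i`, given
their side information `s` and `r`. The bits in `𝓕_r` come from common randomness and those in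
`𝓘'` are transmitted, so the two terminals have the same bit there. All other bits are sampled
by the two terminals independently of each other. -/
def roundLaw [Fintype 𝒮] [Fintype ℛ] (p : PMF (𝒳 × 𝒴 × (Fin t → ZMod 2))) (β : ℝ) (n : ℕ)
    (i : Fin t) (S : Block 𝒳 𝒴 t n → 𝒮) (R : Block 𝒳 𝒴 t n → ℛ)
    (vS vR : Fin (2 ^ n) → ZMod 2) (s : 𝒮) (r : ℛ) : ℝ :=
  ∏ j, senderBit p β n i S j vS s *
    (if j ∈ randomSet p β n i S ∪ sentSet p β n i S R then (if vR j = vS j then 1 else 0)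
      else receiverBit p β n i S R j vR r)

end Round

/-! ### The protocol -/

/-- The joint law of the observations `x`, `y` and of the versions `uA`, `uB` of the sequences
`ū¹, …, ūᵗ` that the two terminals have after `t` rounds. -/
def protocolLaw (p : PMF (𝒳 × 𝒴 × (Fin t → ZMod 2))) (β : ℝ) (n : ℕ)
    (x : Fin (2 ^ n) → 𝒳) (y : Fin (2 ^ n) → 𝒴)
    (uA uB : Fin t → Fin (2 ^ n) → ZMod 2) : ℝ :=
  sourceLaw p n x y * ∏ i : Fin t,
    if Even (i : ℕ) then
      roundLaw p β n i (sideA n i) (sideB n i)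
        (polarTransform n (uA i)) (polarTransform n (uB i))
        (x, Fin.take i i.isLt.le uA) (y, Fin.take i i.isLt.le uB)
    else
      roundLaw p β n i (sideB n i) (sideA n i)
        (polarTransform n (uB i)) (polarTransform n (uA i))
        (y, Fin.take i i.isLt.le uB) (x, Fin.take i i.isLt.le uA)

/-- The law `Q` of `(X̄, Ȳ, U_A^{1:t})`. -/
def lawA (p : PMF (𝒳 × 𝒴 × (Fin t → ZMod 2))) (β : ℝ) (n : ℕ) : Block 𝒳 𝒴 t n → ℝ :=
  fun ω => ∑ uB, protocolLaw p β n ω.1 ω.2.1 ω.2.2 uB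

/-- The law `Q` of `(X̄, Ȳ, U_B^{1:t})`. -/
def lawB (p : PMF (𝒳 × 𝒴 × (Fin t → ZMod 2))) (β : ℝ) (n : ℕ) : Block 𝒳 𝒴 t n → ℝ :=
  fun ω => ∑ uA, protocolLaw p β n ω.1 ω.2.1 uA ω.2.2

/-- The probability that `U_A^{1:t} = U_B^{1:t}`. -/
def agreementProb (p : PMF (𝒳 × 𝒴 × (Fin t → ZMod 2))) (β : ℝ) (n : ℕ) : ℝ :=
  ∑ x, ∑ y, ∑ uA, ∑ uB, if uA = uB then protocolLaw p β n x y uA uB else 0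

end Source

/-- The `L¹` distance of two mass functions on a finite set. -/
def l1Dist {Ω : Type*} [Fintype Ω] (μ ν : Ω → ℝ) : ℝ := ∑ ω, |μ ω - ν ω|

end InteractivePolar

end

/-!
The proof compares the protocol with an ideal one, in which the sender draws every bit from its
ideal conditional law given its side information and the receiver copies it. By the chain rule
(`pr_mul_prod_condBit`) and the Markov conditions, the ideal protocol produces exactly the law
`idealJointLaw` of `(X̄, Ȳ, Ū, Ū)` with `(X̄, Ȳ, Ū)` distributed according to `P`
(`idealJointLaw_eq`). So it suffices to bound the `L¹` distance of the joint law of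
`(X̄, Ȳ, U_A, U_B)` in the protocol from this law: the laws of `U_A` and of `U_B` are marginals, and
the ideal law is concentrated on `U_A = U_B`.

Both laws generate the pairs of bits of the terminals one after the other, in the lexicographic
order of the pairs `(i, j)` of a round and an index. A hybrid argument
(`IsSeqKernel.sum_abs_prod_sub_le`) bounds their distance by the sum over the `t N` steps of the
expected distance of the kernels, where the past is ideal, so that the two terminals agree on it.
By the definition of the index sets, each step costs at most `2 √δ_N`
(`sum_abs_roundStep_sub_idealStep_le`). A bit in `𝓕_r` is nearly uniform given the side information
of the sender, because `E |q₀ - q₁| ≤ √(2 (1 - Z))`. A bit outside `𝓕_r ∪ 𝓘'` is drawn by the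
receiver given information `W` for which `Z ≤ δ_N`; since the true bit has the sender's conditional
law even when `W` is given as well, the bit of the receiver differs from it with probability at most
`E [2 q₀ q₁] ≤ Z / 2`. In `𝓕_d` the sender draws its bit from the same law as the receiver, and the
distance of this law from the ideal one obeys a bound of the same order. The bits in `𝓘'` are
transmitted and cause no error.

The total `2 t N √δ_N` is `O(2^{-N^β₃})` for every `β₃ < β`. Polarization, that is, the asymptotic
size of the index sets, plays no role.
-/

noncomputable section

namespace InteractivePolar

/-! ### Telescoping for products of sequential kernels -/

section Sequential

variable {ι α : Type*}

/-- The law of the coordinates of a random `w : ι → α` that are generated one after the other: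
`a j w` is the probability of the value `w j` given the values `w k` for `k < j`. -/
structure IsSeqKernel [LinearOrder ι] [Fintype α] (a : ι → (ι → α) → ℝ) : Prop where
  nonneg : ∀ j w, 0 ≤ a j w
  dependsOn : ∀ j, DependsOn (a j) (Set.Iic j)
  sum_update : ∀ j w, ∑ c, a j (Function.update w j c) = 1

lemma update_eq_of_dependsOn [DecidableEq ι] {s : Set ι} {f : (ι → α) → ℝ} (hf : DependsOn f s)
    {j : ι} (hj : j ∉ s) (w : ι → α) (c : α) : f (Function.update w j c) = f w :=
  hf fun k hk => Function.update_of_ne (fun h => hj (by rwa [← h])) _ _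

lemma dependsOn_prod {a : ι → (ι → α) → ℝ} {T : Finset ι} {s : Set ι}
    (h : ∀ k ∈ T, DependsOn (a k) s) : DependsOn (fun w => ∏ k ∈ T, a k w) s :=
  fun _ _ hw => Finset.prod_congr rfl fun k hk => h k hk hw

lemma dependsOn_mul {s : Set ι} {f g : (ι → α) → ℝ} (hf : DependsOn f s) (hg : DependsOn g s) :
    DependsOn (fun w => f w * g w) s :=
  fun _ _ hw => congr_arg₂ _ (hf hw) (hg hw)

variable [Fintype ι] [LinearOrder ι] [Fintype α]

/-- Resampling the coordinate `j` counts every point once for each value of the coordinate that is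
overwritten: `(w, c) ↦ (update w j c, w j)` is an involution. -/
lemma sum_sum_update (h : (ι → α) → ℝ) (j : ι) :
    ∑ w, ∑ c, h (Function.update w j c) = Fintype.card α * ∑ w, h w := by
  have hinv : Function.Involutive
      (fun q : (ι → α) × α => (Function.update q.1 j q.2, q.1 j)) := by
    rintro ⟨w, c⟩
    simp
  calc ∑ w, ∑ c, h (Function.update w j c)
      = ∑ q : (ι → α) × α, h (Function.update q.1 j q.2) := by rw [Fintype.sum_prod_type]
    _ = ∑ q : (ι → α) × α, h q.1 := Equiv.sum_comp hinv.toPerm (fun q => h q.1)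
    _ = _ := by
      rw [Fintype.sum_prod_type]
      simp [Finset.mul_sum]

lemma card_mul_sum_mul {g : (ι → α) → ℝ} {j : ι} (hg : ∀ w c, g (Function.update w j c) = g w)
    (h : (ι → α) → ℝ) :
    Fintype.card α * ∑ w, g w * h w = ∑ w, g w * ∑ c, h (Function.update w j c) := by
  rw [← sum_sum_update (fun w => g w * h w) j]
  simp only [hg, Finset.mul_sum]

namespace IsSeqKernel

variable {a b : ι → (ι → α) → ℝ}

/-- Summing out the kernels of the indices in `T` costs only a constant if the remaining factor
does not involve the coordinates in `T`. -/
lemma card_pow_mul_sum (ha : IsSeqKernel a) (T : Finset ι) :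
    ∀ f : (ι → α) → ℝ, DependsOn f (T : Set ι)ᶜ →
      (Fintype.card α : ℝ) ^ T.card * ∑ w, f w * ∏ k ∈ T, a k w = ∑ w, f w := by
  induction T using Finset.induction_on_max with
  | empty => simp
  | insert m T hm ih =>
    intro f hf
    have hmT : m ∉ T := fun h => (hm m h).false
    have hg : ∀ w c, (fun w => f w * ∏ k ∈ T, a k w) (Function.update w m c) =
        f w * ∏ k ∈ T, a k w := by
      intro w c
      simp only
      rw [update_eq_of_dependsOn hf (by simp)]
      congr 1
      exact Finset.prod_congr rfl fun k hk =>
        update_eq_of_dependsOn (ha.dependsOn k) (by simpa using hm k hk) _ _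
    -- Every factor but `a m` is constant in the coordinate of the largest index `m`.
    have key := card_mul_sum_mul (g := fun w => f w * ∏ k ∈ T, a k w) hg (a m)
    simp only [ha.sum_update, mul_one] at key
    rw [Finset.card_insert_of_notMem hmT, pow_succ, mul_assoc]
    have : ∀ w, f w * ∏ k ∈ insert m T, a k w = (f w * ∏ k ∈ T, a k w) * a m w := by
      intro w
      rw [Finset.prod_insert hmT]
      ring
    simp only [this]
    rw [key]
    exact ih f (hf.mono (by simp))

lemma sum_mul_prod_eq [Nonempty α] (ha : IsSeqKernel a) (hb : IsSeqKernel b) {T : Finset ι}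
    {f : (ι → α) → ℝ} (hf : DependsOn f (T : Set ι)ᶜ) :
    ∑ w, f w * ∏ k ∈ T, a k w = ∑ w, f w * ∏ k ∈ T, b k w := by
  have h : (Fintype.card α : ℝ) ^ T.card ≠ 0 := by
    have : (Fintype.card α : ℝ) ≠ 0 := by exact_mod_cast Fintype.card_ne_zero
    positivity
  exact mul_left_cancel₀ h ((ha.card_pow_mul_sum T f hf).trans (hb.card_pow_mul_sum T f hf).symm)

/-- The hybrid law, which uses `b` before `j`, the function `f` at `j` and `a` after `j`, gives
the expectation under `∏ b` of the total mass of `f` at the coordinate `j`. -/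
lemma sum_hybrid [Nonempty α] (ha : IsSeqKernel a) (hb : IsSeqKernel b) (j : ι)
    {f : (ι → α) → ℝ} (hf : DependsOn f (Set.Iic j)) :
    ∑ w, ((∏ k with k < j, b k w) * f w) * ∏ k with j < k, a k w =
      ∑ w, (∏ k, b k w) * ∑ c, f (Function.update w j c) := by
  have hcompl : ((Finset.univ.filter (j < ·) : Finset ι) : Set ι)ᶜ = Set.Iic j := by
    ext; simp
  have hpre : DependsOn (fun w => ∏ k with k < j, b k w) (Set.Iio j) :=
    dependsOn_prod fun k hk =>
      (hb.dependsOn k).mono (Set.Iic_subset_Iio.2 (by simpa using hk))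
  have hpre' := hpre.mono (Set.Iio_subset_Iic_self)
  have hF : DependsOn (fun w => ∑ c, f (Function.update w j c)) (Set.Iio j) := by
    intro w w' hw
    refine Finset.sum_congr rfl fun c _ => hf fun k hk => ?_
    by_cases hkj : k = j
    · subst hkj; simp
    · simpa [hkj] using hw k (lt_of_le_of_ne hk hkj)
  have hsplit : ∀ w, (∏ k, b k w) * ∑ c, f (Function.update w j c) =
      ((∏ k with k < j, b k w) * (b j w * ∑ c, f (Function.update w j c))) *
        ∏ k with j < k, b k w := by
    intro w
    have : ∏ k, b k w = (∏ k with k < j, b k w) * (b j w * ∏ k with j < k, b k w) := by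
      rw [← Finset.prod_filter_mul_prod_filter_not Finset.univ (· < j)]
      congr 1
      have : (Finset.univ.filter (fun k => ¬ k < j)) =
          insert j (Finset.univ.filter (j < ·)) := by
        ext k; simp [le_iff_eq_or_lt, eq_comm]
      rw [this, Finset.prod_insert (by simp)]
    rw [this]
    ring
  simp only [hsplit]
  -- After `j`, replace `a` by `b`, and then sum out these indices on both sides.
  rw [ha.sum_mul_prod_eq hb (by rw [hcompl]; exact dependsOn_mul hpre' hf)]
  have hcard : (Fintype.card α : ℝ) ^ (Finset.univ.filter (j < ·) : Finset ι).card ≠ 0 := by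
    have : (Fintype.card α : ℝ) ≠ 0 := by exact_mod_cast Fintype.card_ne_zero
    positivity
  refine mul_left_cancel₀ hcard ?_
  rw [hb.card_pow_mul_sum _ _ (by rw [hcompl]; exact dependsOn_mul hpre' hf),
    hb.card_pow_mul_sum _ _ (by
      rw [hcompl]
      exact dependsOn_mul hpre' (dependsOn_mul (hb.dependsOn j) (hF.mono Set.Iio_subset_Iic_self)))]
  refine mul_left_cancel₀ (a := (Fintype.card α : ℝ))
    (by exact_mod_cast Fintype.card_ne_zero) ?_
  have hpu : ∀ w c, (fun w => ∏ k with k < j, b k w) (Function.update w j c) =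
      ∏ k with k < j, b k w := fun w c => update_eq_of_dependsOn hpre (by simp) w c
  rw [card_mul_sum_mul (g := fun w => ∏ k with k < j, b k w) hpu,
    card_mul_sum_mul (g := fun w => ∏ k with k < j, b k w) hpu]
  refine Finset.sum_congr rfl fun w _ => ?_
  simp only [update_eq_of_dependsOn hF (show j ∉ Set.Iio j by simp)]
  rw [← Finset.sum_mul, hb.sum_update, one_mul]

/-- The distance of two sequentially generated laws is at most the sum over the steps of the
expected distance of the kernels, where the past is distributed according to the second law. -/
theorem sum_abs_prod_sub_le [Nonempty α] (ha : IsSeqKernel a) (hb : IsSeqKernel b) :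
    ∑ w, |∏ k, a k w - ∏ k, b k w| ≤
      ∑ j, ∑ w, (∏ k, b k w) *
        ∑ c, |a j (Function.update w j c) - b j (Function.update w j c)| := by
  have key : ∀ w, |∏ k, a k w - ∏ k, b k w| ≤
      ∑ j, ((∏ k with k < j, b k w) * |a j w - b j w|) * ∏ k with j < k, a k w := by
    intro w
    have h := Finset.prod_sub_ordered Finset.univ (fun k => a k w) (fun k => a k w - b k w)
    simp only [sub_sub_cancel] at h
    rw [h, sub_sub_cancel]
    refine (Finset.abs_sum_le_sum_abs _ _).trans (Finset.sum_le_sum fun j _ => ?_)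
    rw [abs_mul, abs_mul, abs_of_nonneg (Finset.prod_nonneg fun k _ => hb.nonneg k w),
      abs_of_nonneg (Finset.prod_nonneg fun k _ => ha.nonneg k w),
      mul_comm |a j w - b j w|]
  refine (Finset.sum_le_sum fun w _ => key w).trans ?_
  rw [Finset.sum_comm]
  refine Finset.sum_le_sum fun j _ => ?_
  rw [ha.sum_hybrid hb j (f := fun w => |a j w - b j w|)]
  intro w w' hw
  simp only [ha.dependsOn j hw, hb.dependsOn j hw]

end IsSeqKernel

end Sequential

/-! ### Conditional laws of bits -/

section FiniteProbability

variable {Ω : Type*} [Fintype Ω] {μ : Ω → ℝ}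

lemma pr_nonneg (hμ : ∀ ω, 0 ≤ μ ω) (E : Ω → Prop) : 0 ≤ pr μ E :=
  Finset.sum_nonneg fun ω _ => by split_ifs <;> simp [hμ]

lemma pr_mono (hμ : ∀ ω, 0 ≤ μ ω) {E F : Ω → Prop} (h : ∀ ω, E ω → F ω) : pr μ E ≤ pr μ F := by
  refine Finset.sum_le_sum fun ω _ => ?_
  by_cases hE : E ω
  · simp [hE, h ω hE]
  · simp only [hE, if_false]
    split_ifs <;> simp [hμ]

lemma pr_eq_zero_of_imp (hμ : ∀ ω, 0 ≤ μ ω) {E F : Ω → Prop} (h : ∀ ω, E ω → F ω)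
    (hF : pr μ F = 0) : pr μ E = 0 :=
  le_antisymm ((pr_mono hμ h).trans hF.le) (pr_nonneg hμ E)

lemma pr_congr {E F : Ω → Prop} (h : ∀ ω, E ω ↔ F ω) : pr μ E = pr μ F := by
  rw [show E = F from funext fun ω => propext (h ω)]

lemma sum_mul_comp {𝒮 : Type*} [Fintype 𝒮] (S : Ω → 𝒮) (g : 𝒮 → ℝ) :
    ∑ ω, μ ω * g (S ω) = ∑ s, pr μ (fun ω => S ω = s) * g s := by
  classical
  simp only [pr, Finset.sum_mul]
  rw [Finset.sum_comm]
  refine Finset.sum_congr rfl fun ω _ => ?_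
  simp [ite_mul]

open Classical in
lemma pr_comp {𝒱 α : Type*} [Fintype 𝒱] (V : Ω → 𝒱) (g : 𝒱 → α) (d : α) (E : Ω → Prop) :
    pr μ (fun ω => g (V ω) = d ∧ E ω) =
      ∑ v, if g v = d then pr μ (fun ω => V ω = v ∧ E ω) else 0 := by
  have : ∀ v, (if g v = d then pr μ (fun ω => V ω = v ∧ E ω) else 0) =
      ∑ ω, if V ω = v then (if g (V ω) = d ∧ E ω then μ ω else 0) else 0 := by
    intro v
    by_cases hv : g v = d
    · simp only [hv, if_true, pr]
      refine Finset.sum_congr rfl fun ω _ => ?_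
      by_cases h : V ω = v
      · simp [h, hv]
      · simp [h]
    · simp only [hv, if_false]
      refine (Finset.sum_eq_zero fun ω _ => ?_).symm
      by_cases h : V ω = v
      · simp [h, hv]
      · simp [h]
  simp only [this]
  rw [Finset.sum_comm]
  simp only [pr, Finset.sum_ite_eq, Finset.mem_univ, if_true]
  congr!

lemma IsMarkovChain.comp {𝒱 α γ δ : Type*} [Fintype 𝒱] {V : Ω → 𝒱} {B : Ω → γ} {C : Ω → δ}
    (h : IsMarkovChain μ V B C) (g : 𝒱 → α) : IsMarkovChain μ (fun ω => g (V ω)) B C := by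
  classical
  intro d b c
  rw [pr_comp V g d, pr_comp V g d, Finset.sum_mul, Finset.sum_mul]
  refine Finset.sum_congr rfl fun v _ => ?_
  split_ifs
  · exact h v b c
  · simp

lemma isMarkovChain_unit {α γ : Type*} (A : Ω → α) (B : Ω → γ) :
    IsMarkovChain μ A B (fun _ => ()) := by
  intro a b c
  simp

/-- Part of the first variable of a Markov chain may be moved to the second one. -/
lemma IsMarkovChain.condition {𝒱 α α' γ δ : Type*} [Fintype 𝒱] {V : Ω → 𝒱} {B : Ω → γ}
    {C : Ω → δ} (hμ : ∀ ω, 0 ≤ μ ω) (h : IsMarkovChain μ V B C) (g : 𝒱 → α) (g' : 𝒱 → α') :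
    IsMarkovChain μ (fun ω => g (V ω)) (fun ω => (g' (V ω), B ω)) C := by
  rintro d ⟨d', b⟩ c
  have h1 := h.comp (fun v => (g v, g' v)) (d, d') b c
  have h2 := h.comp g' d' b c
  simp only [Prod.mk.injEq, and_assoc] at h1 h2 ⊢
  by_cases h0 : pr μ (fun ω => B ω = b) = 0
  · have h3 : pr μ (fun ω => g' (V ω) = d' ∧ B ω = b) = 0 :=
      pr_eq_zero_of_imp hμ (fun ω hω => hω.2) h0
    have h4 : pr μ (fun ω => g (V ω) = d ∧ g' (V ω) = d' ∧ B ω = b) = 0 :=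
      pr_eq_zero_of_imp hμ (fun ω hω => hω.2) h3
    rw [h3, h4]
    simp
  · refine mul_right_cancel₀ h0 ?_
    linear_combination (pr μ fun ω => g' (V ω) = d' ∧ B ω = b) * h1 -
      (pr μ fun ω => g (V ω) = d ∧ g' (V ω) = d' ∧ B ω = b) * h2

/-- A component of the second variable of a Markov chain may be copied to the third one. -/
lemma IsMarkovChain.copy_right {α γ γ' δ : Type*} {A : Ω → α} {B : Ω → γ} {B' : Ω → γ'} {C : Ω → δ}
    (h : IsMarkovChain μ A (fun ω => (B ω, B' ω)) C) :
    IsMarkovChain μ A (fun ω => (B ω, B' ω)) (fun ω => (B ω, C ω)) := by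
  rintro a ⟨b, b'⟩ ⟨d, c⟩
  by_cases hbd : b = d
  · subst hbd
    have h1 := h a (b, b') c
    convert h1 using 2
    · exact pr_congr fun ω => by simp only [Prod.mk.injEq]; tauto
    · exact pr_congr fun ω => by simp only [Prod.mk.injEq]; tauto
  · have h0 : ∀ ω, ¬ ((B ω, B' ω) = (b, b') ∧ (B ω, C ω) = (d, c)) := fun ω hω =>
      hbd ((congr_arg Prod.fst hω.1).symm.trans (congr_arg Prod.fst hω.2))
    simp only [h0, and_false, pr, if_false, Finset.sum_const_zero, zero_mul, mul_zero]

section Bit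

variable {𝒮 : Type*} (T : Ω → ZMod 2) (S : Ω → 𝒮)

lemma condBit_nonneg (hμ : ∀ ω, 0 ≤ μ ω) (a : ZMod 2) (s : 𝒮) : 0 ≤ condBit μ T S a s := by
  unfold condBit
  split_ifs
  · norm_num
  · exact div_nonneg (pr_nonneg hμ _) (pr_nonneg hμ _)

lemma pr_mul_condBit (hμ : ∀ ω, 0 ≤ μ ω) (a : ZMod 2) (s : 𝒮) :
    pr μ (fun ω => S ω = s) * condBit μ T S a s = pr μ (fun ω => T ω = a ∧ S ω = s) := by
  unfold condBit
  split_ifs with h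
  · rw [h, zero_mul, pr_eq_zero_of_imp hμ (fun ω hω => hω.2) h]
  · exact mul_div_cancel₀ _ h

lemma sum_zmod_two (f : ZMod 2 → ℝ) : ∑ c, f c = f 0 + f 1 := Fin.sum_univ_two f

lemma sum_pr_bit (E : Ω → Prop) : ∑ c, pr μ (fun ω => T ω = c ∧ E ω) = pr μ E := by
  classical
  simp only [pr]
  rw [Finset.sum_comm]
  refine Finset.sum_congr rfl fun ω _ => ?_
  by_cases h : E ω <;> simp [h]

lemma sum_condBit (s : 𝒮) : ∑ c, condBit μ T S c s = 1 := by
  have h := sum_pr_bit (μ := μ) T (fun ω => S ω = s)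
  unfold condBit
  split_ifs with h0
  · simp [ZMod.card]
  · rw [← Finset.sum_div, h, div_self h0]

lemma condBit_one (s : 𝒮) : condBit μ T S 1 s = 1 - condBit μ T S 0 s := by
  have := sum_condBit (μ := μ) T S s
  rw [sum_zmod_two] at this
  linarith

/-- A bit whose Bhattacharyya parameter is close to `1` is nearly uniform. The inequality
`|q₀ - q₁| ≤ √(2 (1 - 2 √(q₀ q₁)))` is averaged with Jensen's inequality. -/
lemma sum_abs_half_sub_condBit_le [Fintype 𝒮] (hμ : ∀ ω, 0 ≤ μ ω) (hμ1 : ∑ ω, μ ω = 1) :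
    ∑ ω, μ ω * ∑ c, |1 / 2 - condBit μ T S c (S ω)| ≤ √(2 * (1 - bhattacharyya μ T S)) := by
  set z : 𝒮 → ℝ := fun s => 2 * √(condBit μ T S 0 s * condBit μ T S 1 s)
  have hZ : bhattacharyya μ T S = ∑ ω, μ ω * z (S ω) := by
    rw [sum_mul_comp S z]
    simp only [bhattacharyya, Finset.mul_sum, z]
    exact Finset.sum_congr rfl fun s _ => by ring
  have hpt : ∀ s, (∑ c, |1 / 2 - condBit μ T S c s|) ^ 2 ≤ 2 * (1 - z s) := by
    intro s
    have h0 := condBit_nonneg T S hμ 0 s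
    have h1 := condBit_nonneg T S hμ 1 s
    have hz : z s ^ 2 = 4 * (condBit μ T S 0 s * condBit μ T S 1 s) := by
      simp only [z, mul_pow, Real.sq_sqrt (mul_nonneg h0 h1)]
      norm_num
    have hsum : ∑ c, |1 / 2 - condBit μ T S c s| = |1 - 2 * condBit μ T S 0 s| := by
      rw [sum_zmod_two, condBit_one]
      rw [show (1 / 2 - (1 - condBit μ T S 0 s)) = -(1 / 2 - condBit μ T S 0 s) by ring, abs_neg,
        show (1 - 2 * condBit μ T S 0 s) = 2 * (1 / 2 - condBit μ T S 0 s) by ring, abs_mul]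
      norm_num
      ring
    rw [hsum, sq_abs]
    rw [condBit_one] at hz
    nlinarith [sq_nonneg (1 - z s)]
  -- Jensen's inequality for the square, as Cauchy-Schwarz with the weights `μ`.
  have hJ := Finset.sum_mul_sq_le_sq_mul_sq (Finset.univ : Finset Ω) (fun ω => √(μ ω))
    (fun ω => √(μ ω) * ∑ c, |1 / 2 - condBit μ T S c (S ω)|)
  refine Real.le_sqrt_of_sq_le ?_
  have e1 : ∑ ω, √(μ ω) * (√(μ ω) * ∑ c, |1 / 2 - condBit μ T S c (S ω)|) =
      ∑ ω, μ ω * ∑ c, |1 / 2 - condBit μ T S c (S ω)| :=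
    Finset.sum_congr rfl fun ω _ => by rw [← mul_assoc, Real.mul_self_sqrt (hμ ω)]
  have e2 : ∑ ω, √(μ ω) ^ 2 = 1 := by simp only [Real.sq_sqrt (hμ _), hμ1]
  have e3 : ∑ ω, (√(μ ω) * ∑ c, |1 / 2 - condBit μ T S c (S ω)|) ^ 2 =
      ∑ ω, μ ω * (∑ c, |1 / 2 - condBit μ T S c (S ω)|) ^ 2 := by
    simp only [mul_pow, Real.sq_sqrt (hμ _)]
  rw [e1, e2, e3, one_mul] at hJ
  refine hJ.trans ?_
  calc ∑ ω, μ ω * (∑ c, |1 / 2 - condBit μ T S c (S ω)|) ^ 2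
      ≤ ∑ ω, μ ω * (2 * (1 - z (S ω))) :=
        Finset.sum_le_sum fun ω _ => mul_le_mul_of_nonneg_left (hpt _) (hμ ω)
    _ = 2 * (∑ ω, μ ω - ∑ ω, μ ω * z (S ω)) := by
        rw [← Finset.sum_sub_distrib, Finset.mul_sum]
        exact Finset.sum_congr rfl fun ω _ => by ring
    _ = _ := by rw [hμ1, hZ]

/-- The probability that a bit differs from a copy of it that is resampled given `R`, when the
bit itself is sampled given `S` and `R` is conditionally independent of the bit given `S`. -/
lemma sum_condBit_mul_one_sub_le {ℛ : Type*} [Fintype 𝒮] [Fintype ℛ] {T : Ω → ZMod 2}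
    {S : Ω → 𝒮} {R : Ω → ℛ} (hμ : ∀ ω, 0 ≤ μ ω) (h : IsMarkovChain μ T S R) :
    ∑ ω, μ ω * ∑ c, condBit μ T S c (S ω) * (1 - condBit μ T R c (R ω)) ≤
      bhattacharyya μ T R / 2 := by
  have hstep : ∀ c s r, pr μ (fun ω => S ω = s ∧ R ω = r) * condBit μ T S c s =
      pr μ (fun ω => T ω = c ∧ S ω = s ∧ R ω = r) := by
    intro c s r
    by_cases h0 : pr μ (fun ω => S ω = s) = 0
    · rw [pr_eq_zero_of_imp hμ (fun ω hω => hω.1) h0,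
        pr_eq_zero_of_imp hμ (fun ω hω => hω.2.1) h0, zero_mul]
    · refine mul_right_cancel₀ h0 ?_
      rw [h c s r, ← pr_mul_condBit T S hμ]
      ring
  have hsumS : ∀ c r, ∑ s, pr μ (fun ω => T ω = c ∧ S ω = s ∧ R ω = r) =
      pr μ (fun ω => T ω = c ∧ R ω = r) := by
    intro c r
    classical
    simp only [pr]
    rw [Finset.sum_comm]
    refine Finset.sum_congr rfl fun ω _ => ?_
    by_cases h1 : T ω = c <;> by_cases h2 : R ω = r <;> simp [h1, h2]
  rw [sum_mul_comp (fun ω => (S ω, R ω))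
    (fun q => ∑ c, condBit μ T S c q.1 * (1 - condBit μ T R c q.2)), Fintype.sum_prod_type_right]
  simp only [Prod.mk.injEq, bhattacharyya]
  rw [mul_div_cancel_left₀ _ (two_ne_zero)]
  refine Finset.sum_le_sum fun r _ => ?_
  have hE : ∑ s, pr μ (fun ω => S ω = s ∧ R ω = r) *
      ∑ c, condBit μ T S c s * (1 - condBit μ T R c r) =
      pr μ (fun ω => R ω = r) * (2 * (condBit μ T R 0 r * condBit μ T R 1 r)) := by
    calc _ = ∑ c, (∑ s, pr μ (fun ω => T ω = c ∧ S ω = s ∧ R ω = r)) *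
          (1 - condBit μ T R c r) := by
          simp only [Finset.mul_sum, Finset.sum_mul]
          rw [Finset.sum_comm]
          refine Finset.sum_congr rfl fun c _ => Finset.sum_congr rfl fun s _ => ?_
          rw [← mul_assoc, hstep]
      _ = _ := by
          simp only [hsumS, ← pr_mul_condBit T R hμ]
          rw [sum_zmod_two, condBit_one]
          ring
  rw [hE]
  refine mul_le_mul_of_nonneg_left ?_ (pr_nonneg hμ _)
  have h0 := condBit_nonneg T R hμ 0 r
  have h1 := condBit_nonneg T R hμ 1 r
  set q := condBit μ T R 0 r * condBit μ T R 1 r with hq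
  have hq4 : √q ≤ 1 / 2 := by
    rw [Real.sqrt_le_left (by norm_num), hq, condBit_one]
    nlinarith [sq_nonneg (1 - 2 * condBit μ T R 0 r)]
  nlinarith [Real.mul_self_sqrt (mul_nonneg h0 h1), Real.sqrt_nonneg q]

end Bit

/-- The chain rule: the conditional laws of the bits of `V` given the earlier bits and `S` multiply
to the conditional law of `V`, which remains the same when `R` is also given. -/
lemma pr_mul_prod_condBit {𝒮 ℛ : Type*} {N : ℕ} (hμ : ∀ ω, 0 ≤ μ ω) {V : Ω → Fin N → ZMod 2}
    {S : Ω → 𝒮} {R : Ω → ℛ} (h : IsMarkovChain μ V S R) (v : Fin N → ZMod 2) (s : 𝒮) (r : ℛ) :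
    pr μ (fun ω => S ω = s ∧ R ω = r) * ∏ j : Fin N, condBit μ (fun ω => V ω j)
      (fun ω => (Fin.take j j.isLt.le (V ω), S ω)) (v j) (Fin.take j j.isLt.le v, s) =
      pr μ (fun ω => V ω = v ∧ S ω = s ∧ R ω = r) := by
  have hchain : ∀ m (hm : m ≤ N), pr μ (fun ω => S ω = s) * ∏ j : Fin m,
      condBit μ (fun ω => V ω (Fin.castLE hm j))
        (fun ω => (Fin.take j (j.isLt.le.trans hm) (V ω), S ω)) (v (Fin.castLE hm j))
        (Fin.take j (j.isLt.le.trans hm) v, s) =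
      pr μ (fun ω => Fin.take m hm (V ω) = Fin.take m hm v ∧ S ω = s) := by
    intro m
    induction m with
    | zero =>
      intro hm
      simp only [Finset.univ_eq_empty, Finset.prod_empty, mul_one]
      exact pr_congr fun ω => ⟨fun h => ⟨funext fun j => j.elim0, h⟩, fun h => h.2⟩
    | succ m ih =>
      intro hm
      rw [Fin.prod_univ_castSucc, ← mul_assoc]
      have := ih (by omega)
      simp only [Fin.castLE_castSucc, Fin.val_castSucc] at this ⊢
      rw [this]
      have hs := pr_mul_condBit (μ := μ) (fun ω => V ω (Fin.castLE hm (Fin.last m)))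
        (fun ω => (Fin.take m (by omega) (V ω), S ω)) hμ (v (Fin.castLE hm (Fin.last m)))
        (Fin.take m (by omega) v, s)
      simp only [Prod.mk.injEq] at hs
      refine hs.trans (pr_congr fun ω => ?_)
      rw [← and_assoc]
      refine and_congr_left fun _ => ?_
      constructor
      · rintro ⟨h1, h2⟩
        funext k
        refine Fin.lastCases ?_ (fun k => ?_) k
        · exact h1
        · exact congr_fun h2 k
      · intro h1
        exact ⟨congr_fun h1 (Fin.last m), funext fun k => congr_fun h1 k.castSucc⟩
  have hN := hchain N le_rfl
  simp only [Fin.take_eq_self] at hN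
  by_cases h0 : pr μ (fun ω => S ω = s) = 0
  · rw [pr_eq_zero_of_imp hμ (fun ω hω => hω.1) h0,
      pr_eq_zero_of_imp hμ (fun ω hω => hω.2.1) h0, zero_mul]
  · refine mul_right_cancel₀ h0 ?_
    rw [h v s r, ← hN]
    simp only [Fin.castLE_rfl, id]
    ring

end FiniteProbability

/-! ### The polarizing transform is a bijection -/

lemma kroneckerPow_mul_self (n : ℕ) : kroneckerPow n * kroneckerPow n = 1 := by
  induction n with
  | zero => simp [kroneckerPow]
  | succ n ih =>
    have hF : kernelF * kernelF = 1 := by decide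
    simp only [kroneckerPow, Matrix.reindex_apply, Matrix.submatrix_mul_equiv, Matrix.kronecker]
    rw [← Matrix.mul_kronecker_mul, hF, ih, Matrix.one_kronecker_one]
    exact Matrix.submatrix_one_equiv _

lemma polarTransform_injective (n : ℕ) : Function.Injective (polarTransform n) := by
  have h : polarMatrix n * (kroneckerPow n * (bitReversal n)⁻¹.permMatrix (ZMod 2)) = 1 := by
    rw [polarMatrix, Matrix.mul_assoc, ← Matrix.mul_assoc (kroneckerPow n),
      kroneckerPow_mul_self, Matrix.one_mul, ← Matrix.permMatrix_mul]
    simp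
  intro u u' huu'
  have := congr_arg
    (fun v => Matrix.vecMul v (kroneckerPow n * (bitReversal n)⁻¹.permMatrix (ZMod 2))) huu'
  simpa only [polarTransform, Matrix.vecMul_vecMul, h, Matrix.vecMul_one] using this

/-- The polarizing transform as a permutation of the binary vectors. -/
def polarEquiv (n : ℕ) : (Fin (2 ^ n) → ZMod 2) ≃ (Fin (2 ^ n) → ZMod 2) :=
  Equiv.ofBijective (polarTransform n)
    (Finite.injective_iff_bijective.1 (polarTransform_injective n))

lemma polarTransform_polarEquiv_symm (n : ℕ) (v : Fin (2 ^ n) → ZMod 2) :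
    polarTransform n ((polarEquiv n).symm v) = v := (polarEquiv n).apply_symm_apply v

/-! ### The ideal law of a block -/

section BlockLaw

variable {𝒳 𝒴 : Type*} {t : ℕ} (p : PMF (𝒳 × 𝒴 × (Fin t → ZMod 2)))

lemma letterLaw_nonneg (w : 𝒳 × 𝒴 × (Fin t → ZMod 2)) : 0 ≤ letterLaw p w :=
  ENNReal.toReal_nonneg

lemma blockLaw_nonneg (n : ℕ) (ω : Block 𝒳 𝒴 t n) : 0 ≤ blockLaw p n ω :=
  Finset.prod_nonneg fun _ _ => letterLaw_nonneg p _

variable [Fintype 𝒳] [Fintype 𝒴]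

lemma sum_letterLaw : ∑ w, letterLaw p w = 1 := by
  have h := p.tsum_coe
  rw [tsum_fintype] at h
  simp only [letterLaw]
  rw [← ENNReal.toReal_sum fun w _ => p.apply_ne_top w, h, ENNReal.toReal_one]

/-- The `k`-th letter of a block. -/
def letter {n : ℕ} (ω : Block 𝒳 𝒴 t n) (k : Fin (2 ^ n)) : 𝒳 × 𝒴 × (Fin t → ZMod 2) :=
  (ω.1 k, ω.2.1 k, fun i => ω.2.2 i k)

/-- A block as the sequence of its letters. -/
def blockEquiv (n : ℕ) : Block 𝒳 𝒴 t n ≃ (Fin (2 ^ n) → 𝒳 × 𝒴 × (Fin t → ZMod 2)) where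
  toFun := letter
  invFun f := (fun k => (f k).1, fun k => (f k).2.1, fun i k => (f k).2.2 i)
  left_inv _ := rfl
  right_inv _ := rfl

/-- The letters of a block are independent. -/
lemma pr_blockLaw_forall (n : ℕ) (E : Fin (2 ^ n) → 𝒳 × 𝒴 × (Fin t → ZMod 2) → Prop) :
    pr (blockLaw p n) (fun ω => ∀ k, E k (letter ω k)) = ∏ k, pr (letterLaw p) (E k) := by
  classical
  simp only [pr]
  rw [Finset.prod_univ_sum, Fintype.piFinset_univ, ← Equiv.sum_comp (blockEquiv n)]
  refine Finset.sum_congr rfl fun ω _ => ?_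
  by_cases h : ∀ k, E k (letter ω k)
  · rw [if_pos h]
    exact Finset.prod_congr rfl fun k _ => (if_pos (h k)).symm
  · rw [if_neg h]
    push Not at h
    obtain ⟨k, hk⟩ := h
    exact (Finset.prod_eq_zero (Finset.mem_univ k) (if_neg hk)).symm

lemma pr_true {Ω : Type*} [Fintype Ω] (μ : Ω → ℝ) : pr μ (fun _ => True) = ∑ ω, μ ω := by
  simp [pr]

lemma sum_blockLaw (n : ℕ) : ∑ ω, blockLaw p n ω = 1 := by
  have h := pr_blockLaw_forall p n (fun _ _ => True)
  simpa only [implies_true, pr_true, sum_letterLaw, Finset.prod_const_one] using h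

lemma sourceLaw_eq (n : ℕ) (x : Fin (2 ^ n) → 𝒳) (y : Fin (2 ^ n) → 𝒴) :
    sourceLaw p n x y = pr (blockLaw p n) (fun ω => ω.1 = x ∧ ω.2.1 = y) := by
  rw [sourceLaw, ← pr_blockLaw_forall p n (fun k w => w.1 = x k ∧ w.2.1 = y k)]
  exact pr_congr fun ω => by simp only [forall_and, funext_iff, letter]

variable {p}

/-- A Markov chain of single letters gives a Markov chain of blocks. -/
lemma IsMarkovChain.block {α γ δ : Type*} {A : 𝒳 × 𝒴 × (Fin t → ZMod 2) → α}
    {B : 𝒳 × 𝒴 × (Fin t → ZMod 2) → γ} {C : 𝒳 × 𝒴 × (Fin t → ZMod 2) → δ}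
    (h : IsMarkovChain (letterLaw p) A B C) (n : ℕ) :
    IsMarkovChain (blockLaw p n) (fun ω k => A (letter ω k)) (fun ω k => B (letter ω k))
      (fun ω k => C (letter ω k)) := by
  intro a b c
  simp only [funext_iff, ← forall_and]
  rw [pr_blockLaw_forall p n (fun k w => A w = a k ∧ B w = b k ∧ C w = c k),
    pr_blockLaw_forall p n (fun k w => B w = b k),
    pr_blockLaw_forall p n (fun k w => A w = a k ∧ B w = b k),
    pr_blockLaw_forall p n (fun k w => B w = b k ∧ C w = c k),
    ← Finset.prod_mul_distrib, ← Finset.prod_mul_distrib]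
  exact Finset.prod_congr rfl fun k _ => h _ _ _

/-- The Markov chain of a round for blocks. The third variable may be the full side information of
the receiver, since its second component is known to the sender. -/
lemma isMarkovChain_side {𝒵 𝒵' : Type*} {n : ℕ} {i : Fin t}
    {Z : 𝒳 × 𝒴 × (Fin t → ZMod 2) → 𝒵} {Z' : 𝒳 × 𝒴 × (Fin t → ZMod 2) → 𝒵'}
    (h : IsMarkovChain (letterLaw p) (fun w => w.2.2 i)
      (fun w => (Z w, Fin.take i i.isLt.le w.2.2)) Z') :
    IsMarkovChain (blockLaw p n) (vVec n i)
      (fun ω => ((fun k => Z (letter ω k)), Fin.take i i.isLt.le ω.2.2))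
      (fun ω => ((fun k => Z' (letter ω k)), Fin.take i i.isLt.le ω.2.2)) := by
  have hb := (h.block n).comp (polarTransform n)
  rintro v ⟨z, us⟩ ⟨z', us'⟩
  by_cases hus : us = us'
  · subst hus
    have h1 := hb v (fun k => (z k, fun i' => us i' k)) z'
    have e : ∀ ω : Block 𝒳 𝒴 t n,
        ((fun k => Z (letter ω k)), Fin.take i i.isLt.le ω.2.2) = (z, us) ↔
        (fun k => (Z (letter ω k), Fin.take i i.isLt.le (letter ω k).2.2)) =
          fun k => (z k, fun i' => us i' k) := by
      intro ω
      simp only [Prod.mk.injEq, funext_iff, forall_and]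
      exact and_congr_right fun _ => forall_comm
    convert h1 using 2
    · refine pr_congr fun ω => and_congr_right fun _ => ?_
      rw [← e]
      simp only [Prod.mk.injEq]
      tauto
    · exact pr_congr e
    · exact pr_congr fun ω => and_congr_right fun _ => e ω
    · refine pr_congr fun ω => ?_
      rw [← e]
      simp only [Prod.mk.injEq]
      tauto
  · have h0 : ∀ ω : Block 𝒳 𝒴 t n,
        ¬ (((fun k => Z (letter ω k)), Fin.take i i.isLt.le ω.2.2) = (z, us) ∧
          ((fun k => Z' (letter ω k)), Fin.take i i.isLt.le ω.2.2) = (z', us')) := fun ω hω =>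
      hus ((congr_arg Prod.snd hω.1).symm.trans (congr_arg Prod.snd hω.2))
    simp only [h0, and_false, pr, if_false, Finset.sum_const_zero, zero_mul, mul_zero]

lemma MarkovConditions.even (hp : MarkovConditions p) (n : ℕ) {i : Fin t} (hi : Even (i : ℕ)) :
    IsMarkovChain (blockLaw p n) (vVec n i) (sideA n i) (sideB n i) :=
  isMarkovChain_side ((hp i).1 hi)

lemma MarkovConditions.odd (hp : MarkovConditions p) (n : ℕ) {i : Fin t} (hi : ¬ Even (i : ℕ)) :
    IsMarkovChain (blockLaw p n) (vVec n i) (sideB n i) (sideA n i) :=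
  isMarkovChain_side ((hp i).2 hi)

lemma take_succ_eq_iff {α : Type*} {m : ℕ} (hm : m < t) (u u' : Fin t → α) :
    Fin.take (m + 1) hm u = Fin.take (m + 1) hm u' ↔
      u ⟨m, hm⟩ = u' ⟨m, hm⟩ ∧ Fin.take m hm.le u = Fin.take m hm.le u' := by
  constructor
  · intro h
    exact ⟨congr_fun h (Fin.last m), funext fun k => congr_fun h k.castSucc⟩
  · rintro ⟨h1, h2⟩
    funext k
    refine Fin.lastCases ?_ (fun k => ?_) k
    · exact h1
    · exact congr_fun h2 k

/-- The ideal conditional law of the sequence of round `i`, as the product of the ideal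
conditional laws of the bits given the side information of the sender. -/
def idealRound (p : PMF (𝒳 × 𝒴 × (Fin t → ZMod 2))) (n : ℕ) (i : Fin t) (x : Fin (2 ^ n) → 𝒳)
    (y : Fin (2 ^ n) → 𝒴) (u : Fin t → Fin (2 ^ n) → ZMod 2) : ℝ :=
  ∏ j, if Even (i : ℕ) then
      idealBit p n i (sideA n i) j (polarTransform n (u i)) (x, Fin.take i i.isLt.le u)
    else idealBit p n i (sideB n i) j (polarTransform n (u i)) (y, Fin.take i i.isLt.le u)

lemma pr_mul_idealRound (hp : MarkovConditions p) (n : ℕ) (i : Fin t) (x : Fin (2 ^ n) → 𝒳)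
    (y : Fin (2 ^ n) → 𝒴) (u : Fin t → Fin (2 ^ n) → ZMod 2) :
    pr (blockLaw p n) (fun ω => ω.1 = x ∧ ω.2.1 = y ∧
        Fin.take i i.isLt.le ω.2.2 = Fin.take i i.isLt.le u) * idealRound p n i x y u =
      pr (blockLaw p n) (fun ω => ω.1 = x ∧ ω.2.1 = y ∧
        Fin.take (i + 1) i.isLt ω.2.2 = Fin.take (i + 1) i.isLt u) := by
  by_cases hi : Even (i : ℕ)
  · simp only [idealRound, hi, if_true]
    have h := pr_mul_prod_condBit (blockLaw_nonneg p n) (hp.even n hi) (polarTransform n (u i))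
      (x, Fin.take i i.isLt.le u) (y, Fin.take i i.isLt.le u)
    refine (congr_arg₂ (· * ·) (pr_congr fun ω => ?_) rfl).trans (h.trans (pr_congr fun ω => ?_))
    · simp only [sideA, sideB, Prod.mk.injEq]
      tauto
    · symm
      rw [take_succ_eq_iff]
      simp only [sideA, sideB, Prod.mk.injEq, vVec, (polarTransform_injective n).eq_iff]
      tauto
  · simp only [idealRound, hi, if_false]
    have h := pr_mul_prod_condBit (blockLaw_nonneg p n) (hp.odd n hi) (polarTransform n (u i))
      (y, Fin.take i i.isLt.le u) (x, Fin.take i i.isLt.le u)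
    refine (congr_arg₂ (· * ·) (pr_congr fun ω => ?_) rfl).trans (h.trans (pr_congr fun ω => ?_))
    · simp only [sideA, sideB, Prod.mk.injEq]
      tauto
    · symm
      rw [take_succ_eq_iff]
      simp only [sideA, sideB, Prod.mk.injEq, vVec, (polarTransform_injective n).eq_iff]
      tauto

/-- The ideal law is generated round by round from the source, where the sequence of a round is
drawn given only the side information of the sender. -/
lemma sourceLaw_mul_prod_idealRound (hp : MarkovConditions p) (n : ℕ) (x : Fin (2 ^ n) → 𝒳)
    (y : Fin (2 ^ n) → 𝒴) (u : Fin t → Fin (2 ^ n) → ZMod 2) :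
    sourceLaw p n x y * ∏ i, idealRound p n i x y u = blockLaw p n (x, y, u) := by
  have h : ∀ m (hm : m ≤ t), sourceLaw p n x y *
      ∏ i : Fin m, idealRound p n (Fin.castLE hm i) x y u =
      pr (blockLaw p n) (fun ω => ω.1 = x ∧ ω.2.1 = y ∧ Fin.take m hm ω.2.2 = Fin.take m hm u) := by
    intro m
    induction m with
    | zero =>
      intro hm
      rw [sourceLaw_eq]
      simp only [Finset.univ_eq_empty, Finset.prod_empty, mul_one]
      refine pr_congr fun ω => and_congr_right fun _ => ?_
      exact (and_iff_left (funext fun j => j.elim0)).symm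
    | succ m ih =>
      intro hm
      rw [Fin.prod_univ_castSucc, ← mul_assoc]
      have h1 := ih (by omega)
      simp only [Fin.castLE_castSucc] at h1 ⊢
      rw [h1]
      exact pr_mul_idealRound hp n ⟨m, hm⟩ x y u
  have ht := h t le_rfl
  simp only [Fin.castLE_rfl, id] at ht
  rw [ht]
  classical
  simp only [pr, Fin.take_eq_self]
  rw [Finset.sum_eq_single (x, y, u)]
  · simp
  · rintro ⟨x', y', u'⟩ _ hne
    refine if_neg ?_
    rintro ⟨rfl, rfl, rfl⟩
    exact hne rfl
  · simp

end BlockLaw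

/-! ### A single step of a round -/

section Step

variable {𝒳 𝒴 𝒮 ℛ : Type*} [Fintype 𝒳] [Fintype 𝒴] {t : ℕ}
  (p : PMF (𝒳 × 𝒴 × (Fin t → ZMod 2))) (β : ℝ) (n : ℕ) (i : Fin t)
  (S : Block 𝒳 𝒴 t n → 𝒮) (R : Block 𝒳 𝒴 t n → ℛ) (j : Fin (2 ^ n))

open Classical in
/-- The factor of `roundLaw` that belongs to the index `j`. -/
def roundStep [Fintype 𝒮] [Fintype ℛ] (vS vR : Fin (2 ^ n) → ZMod 2) (s : 𝒮) (r : ℛ) : ℝ :=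
  senderBit p β n i S j vS s *
    (if j ∈ randomSet p β n i S ∪ sentSet p β n i S R then (if vR j = vS j then 1 else 0)
      else receiverBit p β n i S R j vR r)

/-- The ideal counterpart of `roundStep`: the sender draws its bit from the ideal conditional law
given its side information, and the receiver has the same bit. -/
def idealStep (vS vR : Fin (2 ^ n) → ZMod 2) (s : 𝒮) : ℝ :=
  idealBit p n i S j vS s * (if vR j = vS j then 1 else 0)

variable {p β n i S R j}

lemma idealBit_nonneg (v : Fin (2 ^ n) → ZMod 2) (s : 𝒮) : 0 ≤ idealBit p n i S j v s :=
  condBit_nonneg _ _ (blockLaw_nonneg p n) _ _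

lemma idealStep_nonneg (vS vR : Fin (2 ^ n) → ZMod 2) (s : 𝒮) :
    0 ≤ idealStep p n i S j vS vR s := by
  refine mul_nonneg (idealBit_nonneg _ _) ?_
  split_ifs <;> norm_num

lemma take_update (v : Fin (2 ^ n) → ZMod 2) (c : ZMod 2) :
    Fin.take j j.isLt.le (Function.update v j c) = Fin.take j j.isLt.le v := by
  funext k
  exact Function.update_of_ne (fun h => (k.isLt.ne (congr_arg Fin.val h))) _ _

lemma idealBit_update (v : Fin (2 ^ n) → ZMod 2) (c : ZMod 2) (s : 𝒮) :
    idealBit p n i S j (Function.update v j c) s =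
      condBit (blockLaw p n) (fun ω => vVec n i ω j)
        (fun ω => (Fin.take j j.isLt.le (vVec n i ω), S ω)) c (Fin.take j j.isLt.le v, s) := by
  rw [idealBit, take_update, Function.update_self]

lemma sum_idealBit_update (v : Fin (2 ^ n) → ZMod 2) (s : 𝒮) :
    ∑ c, idealBit p n i S j (Function.update v j c) s = 1 := by
  simp only [idealBit_update]
  exact sum_condBit _ _ _

lemma sum_idealStep_update (vS vR : Fin (2 ^ n) → ZMod 2) (s : 𝒮) :
    ∑ c, ∑ c', idealStep p n i S j (Function.update vS j c) (Function.update vR j c') s = 1 := by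
  have h : ∀ c, ∑ c', idealStep p n i S j (Function.update vS j c)
      (Function.update vR j c') s = idealBit p n i S j (Function.update vS j c) s := by
    intro c
    simp [idealStep, Function.update_self]
  simp only [h, sum_idealBit_update]

lemma idealBit_congr {v v' : Fin (2 ^ n) → ZMod 2} (h : ∀ k ≤ j, v k = v' k) (s : 𝒮) :
    idealBit p n i S j v s = idealBit p n i S j v' s := by
  have : Fin.take j j.isLt.le v = Fin.take j j.isLt.le v' := funext fun k => h _ k.isLt.le
  rw [idealBit, idealBit, this, h j le_rfl]

lemma idealStep_congr {vS vS' vR vR' : Fin (2 ^ n) → ZMod 2} (hS : ∀ k ≤ j, vS k = vS' k)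
    (hR : ∀ k ≤ j, vR k = vR' k) (s : 𝒮) :
    idealStep p n i S j vS vR s = idealStep p n i S j vS' vR' s := by
  simp only [idealStep, idealBit_congr hS, hS j le_rfl, hR j le_rfl]

variable [Fintype 𝒮]

lemma senderBit_nonneg (v : Fin (2 ^ n) → ZMod 2) (s : 𝒮) : 0 ≤ senderBit p β n i S j v s := by
  unfold senderBit
  split_ifs
  · norm_num
  · exact idealBit_nonneg _ _
  · exact idealBit_nonneg _ _

lemma receiverBit_nonneg (v : Fin (2 ^ n) → ZMod 2) (r : ℛ) :
    0 ≤ receiverBit p β n i S R j v r := by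
  unfold receiverBit
  split_ifs
  · norm_num
  · exact idealBit_nonneg _ _
  · exact idealBit_nonneg _ _

lemma sum_senderBit_update (v : Fin (2 ^ n) → ZMod 2) (s : 𝒮) :
    ∑ c, senderBit p β n i S j (Function.update v j c) s = 1 := by
  unfold senderBit
  split_ifs
  · simp [ZMod.card]
  · exact sum_idealBit_update _ _
  · exact sum_idealBit_update _ _

lemma sum_receiverBit_update (v : Fin (2 ^ n) → ZMod 2) (r : ℛ) :
    ∑ c, receiverBit p β n i S R j (Function.update v j c) r = 1 := by
  unfold receiverBit
  split_ifs
  · simp [ZMod.card]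
  · exact sum_idealBit_update _ _
  · exact sum_idealBit_update _ _

variable [Fintype ℛ]

lemma roundStep_nonneg (vS vR : Fin (2 ^ n) → ZMod 2) (s : 𝒮) (r : ℛ) :
    0 ≤ roundStep p β n i S R j vS vR s r := by
  refine mul_nonneg (senderBit_nonneg _ _) ?_
  split_ifs
  · exact zero_le_one
  · exact le_rfl
  · exact receiverBit_nonneg _ _

lemma sum_roundStep_update (vS vR : Fin (2 ^ n) → ZMod 2) (s : 𝒮) (r : ℛ) :
    ∑ c, ∑ c', roundStep p β n i S R j (Function.update vS j c) (Function.update vR j c') s r =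
      1 := by
  have h : ∀ c, ∑ c', roundStep p β n i S R j (Function.update vS j c)
      (Function.update vR j c') s r = senderBit p β n i S j (Function.update vS j c) s := by
    intro c
    simp only [roundStep, ← Finset.mul_sum]
    split_ifs
    · simp [Function.update_self]
    · rw [sum_receiverBit_update, mul_one]
  simp only [h, sum_senderBit_update]

lemma roundStep_congr {vS vS' vR vR' : Fin (2 ^ n) → ZMod 2} (hS : ∀ k ≤ j, vS k = vS' k)
    (hR : ∀ k ≤ j, vR k = vR' k) (s : 𝒮) (r : ℛ) :
    roundStep p β n i S R j vS vR s r = roundStep p β n i S R j vS' vR' s r := by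
  simp only [roundStep, senderBit, receiverBit, idealBit_congr hS, idealBit_congr hR,
    hS j le_rfl, hR j le_rfl]

lemma threshold_nonneg (β : ℝ) (n : ℕ) : 0 ≤ threshold β n :=
  Real.rpow_nonneg zero_le_two _

lemma threshold_le_one (β : ℝ) (n : ℕ) : threshold β n ≤ 1 :=
  Real.rpow_le_one_of_one_le_of_nonpos one_le_two
    (neg_nonpos.2 (Real.rpow_nonneg (pow_nonneg zero_le_two n) _))

/-- Independent samples of both terminals, from laws `q'` and `q''`, compared with a common bit
from the law `q`. The sum on the right-hand side is the probability that a bit of law `q` differs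
from an independent one of law `q''`; it bounds both `|q c - q'' c|` and `q'' 0 * q'' 1`. -/
lemma sum_abs_independent_sub_common_le {q q' q'' : ZMod 2 → ℝ} (hq : ∀ c, 0 ≤ q c)
    (hq1 : ∑ c, q c = 1) (hq'' : ∀ c, 0 ≤ q'' c) (hq''1 : ∑ c, q'' c = 1)
    (h : q' = q'' ∨ q' = q) :
    ∑ c, ∑ c', |q' c * q'' c' - q c * (if c' = c then 1 else 0)| ≤
      4 * ∑ c, q c * (1 - q'' c) := by
  simp only [sum_zmod_two] at hq1 hq''1 ⊢
  have e : q 1 = 1 - q 0 := by linarith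
  have e'' : q'' 1 = 1 - q'' 0 := by linarith
  have a0 := hq 0
  have a1 := hq 1
  have b0 := hq'' 0
  have b1 := hq'' 1
  simp only [if_true, zero_ne_one, one_ne_zero, if_false, mul_one, mul_zero, sub_zero]
  rcases h with rfl | rfl
  · rw [e] at a1 ⊢
    rw [e''] at b1 ⊢
    generalize q 0 = a at *
    generalize q' 0 = b at *
    have h1 : 0 ≤ a * (1 - b) := mul_nonneg a0 b1
    have h2 : 0 ≤ (1 - a) * b := mul_nonneg a1 b0
    have h3 : |b * b - a| ≤ (a * (1 - b) + (1 - a) * b) * b + a * (1 - b) :=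
      abs_le.2 ⟨by nlinarith [mul_nonneg h1 b0, mul_nonneg h2 b0],
        by nlinarith [mul_nonneg h1 b0, mul_nonneg h2 b0]⟩
    have h4 : |(1 - b) * (1 - b) - (1 - a)| ≤
        (a * (1 - b) + (1 - a) * b) * (1 - b) + (1 - a) * b :=
      abs_le.2 ⟨by nlinarith [mul_nonneg h1 b1, mul_nonneg h2 b1],
        by nlinarith [mul_nonneg h1 b1, mul_nonneg h2 b1]⟩
    rw [abs_of_nonneg (mul_nonneg b0 b1), abs_of_nonneg (mul_nonneg b1 b0)]
    nlinarith [mul_nonneg h1 b1, mul_nonneg h2 b0]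
  · rw [e] at a1 ⊢
    rw [e''] at b1 ⊢
    generalize q' 0 = a at *
    generalize q'' 0 = b at *
    have h1 : 0 ≤ a * (1 - b) := mul_nonneg a0 b1
    have h2 : 0 ≤ (1 - a) * b := mul_nonneg a1 b0
    rw [abs_of_nonneg h1, abs_of_nonneg h2, show a * b - a = -(a * (1 - b)) by ring,
      show (1 - a) * (1 - b) - (1 - a) = -((1 - a) * b) by ring, abs_neg, abs_neg,
      abs_of_nonneg h1, abs_of_nonneg h2]
    linarith

/-- The probability that the ideal bit differs from a copy of it that is resampled given the
earlier bits and the side information `R`, where the index is in the set `𝓛` of `R`. -/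
lemma sum_idealBit_mul_one_sub_le (h : IsMarkovChain (blockLaw p n) (vVec n i) S R)
    (hj : j ∈ lowSet p β n i R) :
    ∑ ω, blockLaw p n ω * (4 * ∑ c, idealBit p n i S j (Function.update (vVec n i ω) j c) (S ω) *
      (1 - idealBit p n i R j (Function.update (vVec n i ω) j c) (R ω))) ≤
      2 * √(threshold β n) := by
  have hμ := blockLaw_nonneg p n
  have h1 := (h.condition hμ (fun v => v j) (fun v => Fin.take j j.isLt.le v)).copy_right
  have h2 := sum_condBit_mul_one_sub_le hμ h1
  have h3 : bhattacharyya (blockLaw p n) (fun ω => vVec n i ω j)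
    (fun ω => (Fin.take j j.isLt.le (vVec n i ω), R ω)) ≤ threshold β n := hj
  have hδ : threshold β n ≤ √(threshold β n) :=
    Real.le_sqrt_of_sq_le (by nlinarith [threshold_nonneg β n, threshold_le_one β n])
  simp only [idealBit_update, mul_left_comm _ (4 : ℝ)]
  rw [← Finset.mul_sum]
  linarith

/-- The error of a single step is small: the bits in `𝓕_r` are nearly uniform given the side
information of the sender, those in `𝓕_d` are nearly determined by the earlier bits, those in `𝓘'`
are exact, and the remaining ones are nearly determined by the side information of the receiver. -/
lemma sum_abs_roundStep_sub_idealStep_le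
    (h : IsMarkovChain (blockLaw p n) (vVec n i) S R) :
    ∑ ω, blockLaw p n ω * ∑ c, ∑ c',
      |roundStep p β n i S R j (Function.update (vVec n i ω) j c)
          (Function.update (vVec n i ω) j c') (S ω) (R ω) -
        idealStep p n i S j (Function.update (vVec n i ω) j c)
          (Function.update (vVec n i ω) j c') (S ω)| ≤ 2 * √(threshold β n) := by
  have hμ := blockLaw_nonneg p n
  have hδ0 := threshold_nonneg β n
  by_cases hr : j ∈ randomSet p β n i S
  · have hZ : 1 - threshold β n ≤ bhattacharyya (blockLaw p n) (fun ω => vVec n i ω j)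
      (fun ω => (Fin.take j j.isLt.le (vVec n i ω), S ω)) := hr.2
    have h1 := sum_abs_half_sub_condBit_le (fun ω => vVec n i ω j)
      (fun ω => (Fin.take j j.isLt.le (vVec n i ω), S ω)) hμ (sum_blockLaw p n)
    have h2 : √(2 * (1 - bhattacharyya (blockLaw p n) (fun ω => vVec n i ω j)
        (fun ω => (Fin.take j j.isLt.le (vVec n i ω), S ω)))) ≤ 2 * √(threshold β n) := by
      rw [Real.sqrt_le_left (by positivity), mul_pow, Real.sq_sqrt hδ0]
      linarith
    refine le_trans (le_of_eq ?_) (h1.trans h2)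
    refine Finset.sum_congr rfl fun ω _ => congr_arg _ (Finset.sum_congr rfl fun c _ => ?_)
    simp only [roundStep, idealStep, senderBit, hr, Set.mem_union, true_or, if_true,
      Function.update_self, idealBit_update, ← sub_mul, abs_mul]
    simp [apply_ite]
  by_cases hd : j ∈ deterministicSet p β n i
  · have hsent : j ∉ sentSet p β n i S R := fun hj => hj.1.1 hd
    refine le_trans (Finset.sum_le_sum fun ω _ => mul_le_mul_of_nonneg_left ?_ (hμ ω))
      (sum_idealBit_mul_one_sub_le (p := p) (S := S) (R := noSide n)
        (isMarkovChain_unit _ _) hd)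
    simp only [roundStep, idealStep, senderBit, receiverBit, hr, hd, hsent, Set.mem_union,
      or_self, if_true, if_false, Function.update_self]
    exact sum_abs_independent_sub_common_le
      (q := (fun c => idealBit p n i S j (Function.update (vVec n i ω) j c) (S ω)))
      (q' := (fun c => idealBit p n i (noSide n) j (Function.update (vVec n i ω) j c) ()))
      (q'' := (fun c => idealBit p n i (noSide n) j (Function.update (vVec n i ω) j c) ()))
      (fun c => idealBit_nonneg _ _)
      (sum_idealBit_update _ _) (fun c => idealBit_nonneg _ _) (sum_idealBit_update _ _)
      (Or.inl rfl)
  by_cases hs : j ∈ sentSet p β n i S R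
  · simp only [roundStep, idealStep, senderBit, hr, hd, hs, Set.mem_union, or_true, if_true,
      if_false, sub_self, abs_zero, Finset.sum_const_zero, mul_zero]
    positivity
  · have hlow : j ∈ lowSet p β n i R := by
      by_contra hlow
      exact hs ⟨⟨hd, fun hH => hr ⟨hd, hH⟩⟩, fun hj => hlow hj.2⟩
    refine le_trans (Finset.sum_le_sum fun ω _ => mul_le_mul_of_nonneg_left ?_ (hμ ω))
      (sum_idealBit_mul_one_sub_le h hlow)
    simp only [roundStep, idealStep, senderBit, receiverBit, hr, hd, hs, Set.mem_union,
      or_self, if_false, Function.update_self]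
    exact sum_abs_independent_sub_common_le
      (q := (fun c => idealBit p n i S j (Function.update (vVec n i ω) j c) (S ω)))
      (q' := (fun c => idealBit p n i S j (Function.update (vVec n i ω) j c) (S ω)))
      (q'' := (fun c => idealBit p n i R j (Function.update (vVec n i ω) j c) (R ω)))
      (fun c => idealBit_nonneg _ _)
      (sum_idealBit_update _ _) (fun c => idealBit_nonneg _ _) (sum_idealBit_update _ _)
      (Or.inr rfl)

end Step

/-! ### The protocol as a sequential law of pairs of bits -/

section Protocol

variable {t n : ℕ}

/-- The bits of Terminal A in round `i`, when `w` lists the pairs of bits of the two terminals in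
the order in which they are generated. -/
def bitsA (w : Fin t ×ₗ Fin (2 ^ n) → ZMod 2 × ZMod 2) (i : Fin t) : Fin (2 ^ n) → ZMod 2 :=
  fun j => (w (toLex (i, j))).1

/-- The bits of Terminal B in round `i`. -/
def bitsB (w : Fin t ×ₗ Fin (2 ^ n) → ZMod 2 × ZMod 2) (i : Fin t) : Fin (2 ^ n) → ZMod 2 :=
  fun j => (w (toLex (i, j))).2

/-- The sequences `ū¹, …, ūᵗ` of Terminal A. -/
def versionA (w : Fin t ×ₗ Fin (2 ^ n) → ZMod 2 × ZMod 2) : Fin t → Fin (2 ^ n) → ZMod 2 :=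
  fun i => (polarEquiv n).symm (bitsA w i)

/-- The sequences `ū¹, …, ūᵗ` of Terminal B. -/
def versionB (w : Fin t ×ₗ Fin (2 ^ n) → ZMod 2 × ZMod 2) : Fin t → Fin (2 ^ n) → ZMod 2 :=
  fun i => (polarEquiv n).symm (bitsB w i)

/-- The sequences of the two terminals correspond to the pairs of bits that they generate. -/
def bitsEquiv (t n : ℕ) : (Fin t → Fin (2 ^ n) → ZMod 2) × (Fin t → Fin (2 ^ n) → ZMod 2) ≃
    (Fin t ×ₗ Fin (2 ^ n) → ZMod 2 × ZMod 2) where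
  toFun q k := (polarTransform n (q.1 (ofLex k).1) (ofLex k).2,
    polarTransform n (q.2 (ofLex k).1) (ofLex k).2)
  invFun w := (versionA w, versionB w)
  left_inv q := Prod.ext (funext fun i => (polarEquiv n).symm_apply_apply (q.1 i))
    (funext fun i => (polarEquiv n).symm_apply_apply (q.2 i))
  right_inv w := by
    funext k
    simp only [versionA, versionB, polarTransform_polarEquiv_symm]
    rfl

variable (uA uB : Fin t → Fin (2 ^ n) → ZMod 2)

lemma bitsA_bitsEquiv (i : Fin t) : bitsA (bitsEquiv t n (uA, uB)) i = polarTransform n (uA i) :=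
  rfl

lemma bitsB_bitsEquiv (i : Fin t) : bitsB (bitsEquiv t n (uA, uB)) i = polarTransform n (uB i) :=
  rfl

lemma versionA_bitsEquiv : versionA (bitsEquiv t n (uA, uB)) = uA :=
  congr_arg Prod.fst ((bitsEquiv t n).symm_apply_apply (uA, uB))

lemma versionB_bitsEquiv : versionB (bitsEquiv t n (uA, uB)) = uB :=
  congr_arg Prod.snd ((bitsEquiv t n).symm_apply_apply (uA, uB))

section Dependence

variable {w w' : Fin t ×ₗ Fin (2 ^ n) → ZMod 2 × ZMod 2} {i : Fin t} {j : Fin (2 ^ n)}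

lemma bits_eq_of_forall_le (h : ∀ k ∈ Set.Iic (toLex (i, j)), w k = w' k) :
    (∀ l ≤ j, bitsA w i l = bitsA w' i l) ∧ ∀ l ≤ j, bitsB w i l = bitsB w' i l := by
  have h' : ∀ l ≤ j, w (toLex (i, l)) = w' (toLex (i, l)) := fun l hl =>
    h _ (Prod.Lex.le_iff.2 (Or.inr ⟨rfl, hl⟩))
  exact ⟨fun l hl => congr_arg Prod.fst (h' l hl), fun l hl => congr_arg Prod.snd (h' l hl)⟩

lemma take_version_eq_of_forall_lt (h : ∀ i' < i, ∀ l, w (toLex (i', l)) = w' (toLex (i', l))) :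
    Fin.take i i.isLt.le (versionA w) = Fin.take i i.isLt.le (versionA w') ∧
      Fin.take i i.isLt.le (versionB w) = Fin.take i i.isLt.le (versionB w') := by
  constructor <;> funext m <;> refine congr_arg (polarEquiv n).symm (funext fun l => ?_)
  · exact congr_arg Prod.fst (h _ m.isLt l)
  · exact congr_arg Prod.snd (h _ m.isLt l)

lemma take_version_eq_of_forall_le (h : ∀ k ∈ Set.Iic (toLex (i, j)), w k = w' k) :
    Fin.take i i.isLt.le (versionA w) = Fin.take i i.isLt.le (versionA w') ∧
      Fin.take i i.isLt.le (versionB w) = Fin.take i i.isLt.le (versionB w') :=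
  take_version_eq_of_forall_lt fun _ hi' _ => h _ (Prod.Lex.le_iff.2 (Or.inl hi'))

lemma take_version_update (w : Fin t ×ₗ Fin (2 ^ n) → ZMod 2 × ZMod 2) (c : ZMod 2 × ZMod 2) :
    Fin.take i i.isLt.le (versionA (Function.update w (toLex (i, j)) c)) =
        Fin.take i i.isLt.le (versionA w) ∧
      Fin.take i i.isLt.le (versionB (Function.update w (toLex (i, j)) c)) =
        Fin.take i i.isLt.le (versionB w) :=
  take_version_eq_of_forall_lt fun _ hi' _ => Function.update_of_ne
    (fun h => hi'.ne (congr_arg Prod.fst (toLex.injective h))) _ _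

lemma bitsA_update (w : Fin t ×ₗ Fin (2 ^ n) → ZMod 2 × ZMod 2) (c : ZMod 2 × ZMod 2) :
    bitsA (Function.update w (toLex (i, j)) c) i = Function.update (bitsA w i) j c.1 := by
  funext l
  by_cases hl : l = j
  · subst hl; simp [bitsA]
  · simp [bitsA, hl]

lemma bitsB_update (w : Fin t ×ₗ Fin (2 ^ n) → ZMod 2 × ZMod 2) (c : ZMod 2 × ZMod 2) :
    bitsB (Function.update w (toLex (i, j)) c) i = Function.update (bitsB w i) j c.2 := by
  funext l
  by_cases hl : l = j
  · subst hl; simp [bitsB]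
  · simp [bitsB, hl]

end Dependence

variable {𝒳 𝒴 : Type*} [Fintype 𝒳] [Fintype 𝒴] (p : PMF (𝒳 × 𝒴 × (Fin t → ZMod 2))) (β : ℝ)
  (n) (x : Fin (2 ^ n) → 𝒳) (y : Fin (2 ^ n) → 𝒴)

/-- The conditional law of the pair of bits of the terminals with index `j` in round `i`, where
`k = (i, j)`, given all earlier pairs. -/
def protocolKernel (k : Fin t ×ₗ Fin (2 ^ n)) (w : Fin t ×ₗ Fin (2 ^ n) → ZMod 2 × ZMod 2) : ℝ :=
  if Even ((ofLex k).1 : ℕ) then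
    roundStep p β n (ofLex k).1 (sideA n (ofLex k).1) (sideB n (ofLex k).1) (ofLex k).2
      (bitsA w (ofLex k).1) (bitsB w (ofLex k).1)
      (x, Fin.take (ofLex k).1 (ofLex k).1.isLt.le (versionA w))
      (y, Fin.take (ofLex k).1 (ofLex k).1.isLt.le (versionB w))
  else
    roundStep p β n (ofLex k).1 (sideB n (ofLex k).1) (sideA n (ofLex k).1) (ofLex k).2
      (bitsB w (ofLex k).1) (bitsA w (ofLex k).1)
      (y, Fin.take (ofLex k).1 (ofLex k).1.isLt.le (versionB w))
      (x, Fin.take (ofLex k).1 (ofLex k).1.isLt.le (versionA w))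

/-- The kernels of the ideal protocol, in which the sender follows the ideal law and the receiver
copies every bit of the sender. -/
def idealKernel (k : Fin t ×ₗ Fin (2 ^ n)) (w : Fin t ×ₗ Fin (2 ^ n) → ZMod 2 × ZMod 2) : ℝ :=
  if Even ((ofLex k).1 : ℕ) then
    idealStep p n (ofLex k).1 (sideA n (ofLex k).1) (ofLex k).2
      (bitsA w (ofLex k).1) (bitsB w (ofLex k).1)
      (x, Fin.take (ofLex k).1 (ofLex k).1.isLt.le (versionA w))
  else
    idealStep p n (ofLex k).1 (sideB n (ofLex k).1) (ofLex k).2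
      (bitsB w (ofLex k).1) (bitsA w (ofLex k).1)
      (y, Fin.take (ofLex k).1 (ofLex k).1.isLt.le (versionB w))

lemma isSeqKernel_protocolKernel : IsSeqKernel (protocolKernel n p β x y) where
  nonneg k w := by
    unfold protocolKernel
    split_ifs <;> exact roundStep_nonneg _ _ _ _
  dependsOn k w w' h := by
    obtain ⟨hA, hB⟩ := bits_eq_of_forall_le (i := (ofLex k).1) (j := (ofLex k).2) h
    obtain ⟨hA', hB'⟩ := take_version_eq_of_forall_le (i := (ofLex k).1) (j := (ofLex k).2) h
    simp only [protocolKernel, hA', hB', roundStep_congr hA hB, roundStep_congr hB hA]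
  sum_update k w := by
    obtain ⟨⟨i, j⟩, rfl⟩ := toLex.surjective k
    by_cases hi : Even (i : ℕ)
    · simp only [protocolKernel, ofLex_toLex, hi, if_true, bitsA_update, bitsB_update,
        take_version_update]
      rw [Fintype.sum_prod_type]
      exact sum_roundStep_update _ _ _ _
    · simp only [protocolKernel, ofLex_toLex, hi, if_false, bitsA_update, bitsB_update,
        take_version_update]
      rw [Fintype.sum_prod_type_right]
      exact sum_roundStep_update _ _ _ _

lemma isSeqKernel_idealKernel : IsSeqKernel (idealKernel n p x y) where
  nonneg k w := by
    unfold idealKernel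
    split_ifs <;> exact idealStep_nonneg _ _ _
  dependsOn k w w' h := by
    obtain ⟨hA, hB⟩ := bits_eq_of_forall_le (i := (ofLex k).1) (j := (ofLex k).2) h
    obtain ⟨hA', hB'⟩ := take_version_eq_of_forall_le (i := (ofLex k).1) (j := (ofLex k).2) h
    simp only [idealKernel, hA', hB', idealStep_congr hA hB, idealStep_congr hB hA]
  sum_update k w := by
    obtain ⟨⟨i, j⟩, rfl⟩ := toLex.surjective k
    by_cases hi : Even (i : ℕ)
    · simp only [idealKernel, ofLex_toLex, hi, if_true, bitsA_update, bitsB_update,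
        take_version_update]
      rw [Fintype.sum_prod_type]
      exact sum_idealStep_update _ _ _
    · simp only [idealKernel, ofLex_toLex, hi, if_false, bitsA_update, bitsB_update,
        take_version_update]
      rw [Fintype.sum_prod_type_right]
      exact sum_idealStep_update _ _ _

lemma prod_lex (f : Fin t ×ₗ Fin (2 ^ n) → ℝ) : ∏ k, f k = ∏ i, ∏ j, f (toLex (i, j)) := by
  rw [← Fintype.prod_prod_type', ← Equiv.prod_comp toLex]

lemma protocolLaw_eq : protocolLaw p β n x y uA uB =
    sourceLaw p n x y * ∏ k, protocolKernel n p β x y k (bitsEquiv t n (uA, uB)) := by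
  rw [protocolLaw, prod_lex]
  refine congr_arg _ (Finset.prod_congr rfl fun i _ => ?_)
  simp only [protocolKernel, ofLex_toLex, bitsA_bitsEquiv, bitsB_bitsEquiv, versionA_bitsEquiv,
    versionB_bitsEquiv]
  split_ifs <;> rfl

open Classical in
/-- The joint law of the observations and of two identical copies of the ideal sequences. -/
def idealJointLaw : ℝ := if uA = uB then blockLaw p n (x, y, uA) else 0

variable {p}

lemma idealJointLaw_eq (hp : MarkovConditions p) : idealJointLaw n uA uB p x y =
    sourceLaw p n x y * ∏ k, idealKernel n p x y k (bitsEquiv t n (uA, uB)) := by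
  unfold idealJointLaw
  split_ifs with h
  · subst h
    rw [← sourceLaw_mul_prod_idealRound hp, prod_lex]
    refine congr_arg _ (Finset.prod_congr rfl fun i _ => Finset.prod_congr rfl fun j _ => ?_)
    simp only [idealKernel, ofLex_toLex, bitsA_bitsEquiv, bitsB_bitsEquiv, versionA_bitsEquiv,
      versionB_bitsEquiv, idealStep, if_true, mul_one]
  · obtain ⟨i, hi⟩ := Function.ne_iff.1 h
    obtain ⟨j, hj⟩ := Function.ne_iff.1 ((polarTransform_injective n).ne hi)
    refine (mul_eq_zero_of_right _ (Finset.prod_eq_zero (Finset.mem_univ (toLex (i, j))) ?_)).symm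
    simp only [idealKernel, ofLex_toLex, bitsA_bitsEquiv, bitsB_bitsEquiv, idealStep, hj, hj.symm,
      if_false, mul_zero, ite_self]

lemma sourceLaw_nonneg : 0 ≤ sourceLaw p n x y := by
  rw [sourceLaw_eq]
  exact pr_nonneg (blockLaw_nonneg p n) _

/-- The expected distance of the kernels of the actual and of the ideal protocol. -/
lemma sum_abs_protocolKernel_sub_le (hp : MarkovConditions p) (k : Fin t ×ₗ Fin (2 ^ n)) :
    ∑ ω : Block 𝒳 𝒴 t n, blockLaw p n ω * ∑ c,
      |protocolKernel n p β ω.1 ω.2.1 k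
          (Function.update (bitsEquiv t n (ω.2.2, ω.2.2)) k c) -
        idealKernel n p ω.1 ω.2.1 k
          (Function.update (bitsEquiv t n (ω.2.2, ω.2.2)) k c)| ≤ 2 * √(threshold β n) := by
  obtain ⟨⟨i, j⟩, rfl⟩ := toLex.surjective k
  by_cases hi : Even (i : ℕ)
  · simp only [protocolKernel, idealKernel, ofLex_toLex, hi, if_true, bitsA_update, bitsB_update,
      take_version_update, bitsA_bitsEquiv, bitsB_bitsEquiv, versionA_bitsEquiv,
      versionB_bitsEquiv, Fintype.sum_prod_type (f := fun c : ZMod 2 × ZMod 2 => |_|)]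
    exact sum_abs_roundStep_sub_idealStep_le (hp.even n hi)
  · simp only [protocolKernel, idealKernel, ofLex_toLex, hi, if_false, bitsA_update, bitsB_update,
      take_version_update, bitsA_bitsEquiv, bitsB_bitsEquiv, versionA_bitsEquiv,
      versionB_bitsEquiv, Fintype.sum_prod_type_right (f := fun c : ZMod 2 × ZMod 2 => |_|)]
    exact sum_abs_roundStep_sub_idealStep_le (hp.odd n hi)

/-- The joint law of the observations and of the sequences of both terminals is close to the joint
law of the observations and of two identical copies of the ideal sequences. -/
theorem sum_abs_protocolLaw_sub_le (hp : MarkovConditions p) :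
    ∑ x, ∑ y, ∑ uA, ∑ uB, |protocolLaw p β n x y uA uB - idealJointLaw n uA uB p x y| ≤
      t * 2 ^ n * (2 * √(threshold β n)) := by
  have hxy : ∀ x y, ∑ uA, ∑ uB, |protocolLaw p β n x y uA uB - idealJointLaw n uA uB p x y| ≤
      ∑ k, ∑ u, blockLaw p n (x, y, u) * ∑ c,
        |protocolKernel n p β x y k (Function.update (bitsEquiv t n (u, u)) k c) -
          idealKernel n p x y k (Function.update (bitsEquiv t n (u, u)) k c)| := by
    intro x y
    have h0 := sourceLaw_nonneg (p := p) n x y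
    have h := mul_le_mul_of_nonneg_left ((isSeqKernel_protocolKernel n p β x y).sum_abs_prod_sub_le
      (isSeqKernel_idealKernel n p x y)) h0
    -- Since the ideal law is concentrated on `uA = uB`, only the diagonal of the expectation remains.
    refine (le_of_eq ?_).trans (h.trans (le_of_eq ?_))
    · rw [← Equiv.sum_comp (bitsEquiv t n), Fintype.sum_prod_type, Finset.mul_sum]
      refine Finset.sum_congr rfl fun uA _ => ?_
      rw [Finset.mul_sum]
      refine Finset.sum_congr rfl fun uB _ => ?_
      rw [protocolLaw_eq, idealJointLaw_eq n uA uB x y hp, ← mul_sub, abs_mul, abs_of_nonneg h0]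
    · rw [Finset.mul_sum]
      refine Finset.sum_congr rfl fun k _ => ?_
      rw [← Equiv.sum_comp (bitsEquiv t n), Fintype.sum_prod_type, Finset.mul_sum]
      refine Finset.sum_congr rfl fun u _ => ?_
      rw [Finset.mul_sum, Finset.sum_eq_single u]
      · rw [← mul_assoc, ← idealJointLaw_eq n u u x y hp, idealJointLaw, if_pos rfl]
      · intro u' _ hne
        rw [← mul_assoc, ← idealJointLaw_eq n u u' x y hp, idealJointLaw, if_neg hne.symm, zero_mul]
      · simp
  calc _ ≤ ∑ x, ∑ y, ∑ k, ∑ u, blockLaw p n (x, y, u) * ∑ c,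
        |protocolKernel n p β x y k (Function.update (bitsEquiv t n (u, u)) k c) -
          idealKernel n p x y k (Function.update (bitsEquiv t n (u, u)) k c)| :=
        Finset.sum_le_sum fun x _ => Finset.sum_le_sum fun y _ => hxy x y
    _ = ∑ k, ∑ ω : Block 𝒳 𝒴 t n, blockLaw p n ω * ∑ c,
        |protocolKernel n p β ω.1 ω.2.1 k (Function.update (bitsEquiv t n (ω.2.2, ω.2.2)) k c) -
          idealKernel n p ω.1 ω.2.1 k (Function.update (bitsEquiv t n (ω.2.2, ω.2.2)) k c)| := by
        simp only [Fintype.sum_prod_type (α₁ := Fin (2 ^ n) → 𝒳),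
          Fintype.sum_prod_type (α₁ := Fin (2 ^ n) → 𝒴)]
        refine (Finset.sum_congr rfl fun x _ => Finset.sum_comm).trans ?_
        exact Finset.sum_comm
    _ ≤ ∑ _k : Fin t ×ₗ Fin (2 ^ n), 2 * √(threshold β n) :=
        Finset.sum_le_sum fun k _ => sum_abs_protocolKernel_sub_le n β hp k
    _ = _ := by
        simp only [Finset.sum_const, Finset.card_univ, Fintype.card_lex, Fintype.card_prod,
          Fintype.card_fin, nsmul_eq_mul]
        push_cast
        ring

/-- The law of one terminal is a marginal of the joint law, so its
distance from the ideal law is no larger than that of the joint laws. -/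
lemma l1Dist_lawA_le (hp : MarkovConditions p) :
    l1Dist (lawA p β n) (blockLaw p n) ≤ t * 2 ^ n * (2 * √(threshold β n)) := by
  refine le_trans ?_ (sum_abs_protocolLaw_sub_le n β hp)
  rw [l1Dist, Fintype.sum_prod_type]
  refine Finset.sum_le_sum fun x _ => ?_
  rw [Fintype.sum_prod_type]
  refine Finset.sum_le_sum fun y _ => Finset.sum_le_sum fun u _ => ?_
  have h : blockLaw p n (x, y, u) = ∑ uB, idealJointLaw n u uB p x y := by
    simp [idealJointLaw]
  rw [h]
  simp only [lawA]
  rw [← Finset.sum_sub_distrib]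
  exact Finset.abs_sum_le_sum_abs _ _

lemma l1Dist_lawB_le (hp : MarkovConditions p) :
    l1Dist (lawB p β n) (blockLaw p n) ≤ t * 2 ^ n * (2 * √(threshold β n)) := by
  refine le_trans ?_ (sum_abs_protocolLaw_sub_le n β hp)
  rw [l1Dist, Fintype.sum_prod_type]
  refine Finset.sum_le_sum fun x _ => ?_
  rw [Fintype.sum_prod_type]
  refine Finset.sum_le_sum fun y _ => ?_
  rw [Finset.sum_comm]
  refine Finset.sum_le_sum fun u _ => ?_
  have h : blockLaw p n (x, y, u) = ∑ uA, idealJointLaw n uA u p x y := by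
    simp [idealJointLaw]
  rw [h]
  simp only [lawB]
  rw [← Finset.sum_sub_distrib]
  exact Finset.abs_sum_le_sum_abs _ _

lemma abs_one_sub_agreementProb_le (hp : MarkovConditions p) :
    |1 - agreementProb p β n| ≤ t * 2 ^ n * (2 * √(threshold β n)) := by
  refine le_trans ?_ (sum_abs_protocolLaw_sub_le n β hp)
  have h1 : (1 : ℝ) = ∑ x, ∑ y, ∑ uA, ∑ uB, if uA = uB then idealJointLaw n uA uB p x y else 0 := by
    rw [← sum_blockLaw p n, Fintype.sum_prod_type]
    refine Finset.sum_congr rfl fun x _ => ?_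
    rw [Fintype.sum_prod_type]
    simp [idealJointLaw]
  rw [h1, agreementProb, abs_sub_comm]
  simp only [← Finset.sum_sub_distrib]
  refine (Finset.abs_sum_le_sum_abs _ _).trans (Finset.sum_le_sum fun x _ => ?_)
  refine (Finset.abs_sum_le_sum_abs _ _).trans (Finset.sum_le_sum fun y _ => ?_)
  refine (Finset.abs_sum_le_sum_abs _ _).trans (Finset.sum_le_sum fun uA _ => ?_)
  refine (Finset.abs_sum_le_sum_abs _ _).trans (Finset.sum_le_sum fun uB _ => ?_)
  split_ifs
  · exact le_rfl
  · simp

end Protocol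

/-! ### Asymptotics -/

/-- A polynomial factor in `N = 2 ^ n` and a square root of the threshold cost only an arbitrarily
small part of the exponent. -/
lemma isBigO_pow_mul_sqrt_threshold {β β₃ : ℝ} (hβ : 0 < β) (hβ₃ : β₃ < β) (t : ℕ) :
    (fun n : ℕ => (t : ℝ) * 2 ^ n * (2 * √(threshold β n))) =O[Filter.atTop]
      (fun n : ℕ => (2 : ℝ) ^ (-(((2 : ℝ) ^ n) ^ β₃))) := by
  have hpow : ∀ γ : ℝ, ∀ n : ℕ, ((2 : ℝ) ^ n) ^ γ = ((2 : ℝ) ^ γ) ^ n := by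
    intro γ n
    rw [← Real.rpow_natCast, ← Real.rpow_natCast, ← Real.rpow_mul zero_le_two,
      ← Real.rpow_mul zero_le_two, mul_comm]
  have hexp : ∀ᶠ n : ℕ in Filter.atTop,
      (n : ℝ) + ((2 : ℝ) ^ n) ^ β₃ ≤ ((2 : ℝ) ^ n) ^ β / 2 := by
    have h1 := (isLittleO_coe_const_pow_of_one_lt (R := ℝ)
      (Real.one_lt_rpow one_lt_two hβ)).bound (show (0 : ℝ) < 1 / 4 by norm_num)
    have h2 := (isLittleO_pow_pow_of_lt_left (Real.rpow_nonneg zero_le_two β₃)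
      (Real.rpow_lt_rpow_of_exponent_lt one_lt_two hβ₃)).bound (show (0 : ℝ) < 1 / 4 by norm_num)
    filter_upwards [h1, h2] with n hn1 hn2
    rw [hpow, hpow]
    have e : ‖((2 : ℝ) ^ β) ^ n‖ = ((2 : ℝ) ^ β) ^ n := Real.norm_of_nonneg (by positivity)
    rw [e] at hn1 hn2
    have := (le_abs_self _).trans hn1
    have := (le_abs_self _).trans hn2
    linarith
  refine Asymptotics.IsBigO.of_bound (2 * t) ?_
  filter_upwards [hexp] with n hn
  have hsqrt : √(threshold β n) = (2 : ℝ) ^ (-(((2 : ℝ) ^ n) ^ β / 2)) := by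
    rw [threshold, Real.sqrt_eq_rpow, ← Real.rpow_mul zero_le_two]
    congr 1
    ring
  have hle : (2 : ℝ) ^ n * √(threshold β n) ≤ (2 : ℝ) ^ (-(((2 : ℝ) ^ n) ^ β₃)) := by
    rw [hsqrt, ← Real.rpow_natCast 2 n, ← Real.rpow_add two_pos]
    refine Real.rpow_le_rpow_of_exponent_le one_le_two ?_
    rw [Real.rpow_natCast]
    linarith
  rw [Real.norm_of_nonneg (by positivity), Real.norm_of_nonneg (by positivity)]
  calc (t : ℝ) * 2 ^ n * (2 * √(threshold β n)) = 2 * t * (2 ^ n * √(threshold β n)) := by ring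
    _ ≤ _ := mul_le_mul_of_nonneg_left hle (by positivity)

end InteractivePolar

end

theorem mainTheorem2 {𝒳 𝒴 : Type*} [Fintype 𝒳] [Fintype 𝒴] (t : ℕ)
    (p : PMF (𝒳 × 𝒴 × (Fin t → ZMod 2))) (hp : InteractivePolar.MarkovConditions p)
    (β β₃ : ℝ) (hβ : 0 < β) (hβ' : β < 1 / 2) (hβ₃ : β₃ < β) :
    Asymptotics.IsBigO Filter.atTop
        (fun n : ℕ => 1 - InteractivePolar.agreementProb p β n)
        (fun n : ℕ => (2 : ℝ) ^ (-(((2 : ℝ) ^ n) ^ β₃))) ∧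
      Asymptotics.IsBigO Filter.atTop
        (fun n : ℕ => InteractivePolar.l1Dist (InteractivePolar.lawA p β n)
          (InteractivePolar.blockLaw p n))
        (fun n : ℕ => (2 : ℝ) ^ (-(((2 : ℝ) ^ n) ^ β₃))) ∧
      Asymptotics.IsBigO Filter.atTop
        (fun n : ℕ => InteractivePolar.l1Dist (InteractivePolar.lawB p β n)
          (InteractivePolar.blockLaw p n))
        (fun n : ℕ => (2 : ℝ) ^ (-(((2 : ℝ) ^ n) ^ β₃))) := by
  have hO := InteractivePolar.isBigO_pow_mul_sqrt_threshold hβ hβ₃ t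
  refine ⟨Asymptotics.IsBigO.trans (.of_bound' (.of_forall fun n => ?_)) hO,
    Asymptotics.IsBigO.trans (.of_bound' (.of_forall fun n => ?_)) hO,
    Asymptotics.IsBigO.trans (.of_bound' (.of_forall fun n => ?_)) hO⟩
  · exact (InteractivePolar.abs_one_sub_agreementProb_le n β hp).trans (le_abs_self _)
  · rw [InteractivePolar.l1Dist, Real.norm_of_nonneg (Finset.sum_nonneg fun _ _ => abs_nonneg _)]
    exact (InteractivePolar.l1Dist_lawA_le n β hp).trans (le_abs_self _)
  · rw [InteractivePolar.l1Dist, Real.norm_of_nonneg (Finset.sum_nonneg fun _ _ => abs_nonneg _)]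
    exact (InteractivePolar.l1Dist_lawB_le n β hp).trans (le_abs_self _)
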